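/- Let $m\ge 1$ be an integer and $\beta\in(1,m+1]$. A $\beta$-expansion of $x\in\mathbb R$ is a sequence $(\epsilon_i)_{i\ge1}\in\{0,\dots,m\}^{\mathbb N}$ with $x=\sum_{i=1}^\infty \epsilon_i\beta^{-i}$. Let $$W_{\beta,m}=\Big\{x\in\Big(\frac{m+1-\beta}{\beta-1},1\Big): x \text{ has exactly one } \beta\text{-expansion}\Big\}.$$ Put $\mathcal G(2k)=k+1$ and $\mathcal G(2k+1)=\frac{k+1+\sqrt{k^2+6k+5}}{2}$. Let $(\lambda_i)_{i\ge0}$ be the Thue–Morse sequence: $\lambda_0=0$, $\lambda_{2i}=\lambda_i$, $\lambda_{2i+1}=1-\lambda_i$. For $i\ge1$ put $\lambda_i(m)=k+\lambda_i-\lambda_{i-1}$ if $m=2k$ and $\lambda_i(m)=k+\lambda_i$ if $m=2k+1$. **Theorem.** For every $m\ge1$ the equation $\sum_{i=1}^\infty\lambda_i(m)\beta^{-i}=1$ has a unique solution $\beta=\beta_c(m)$ in $(1,\infty)$, and the following holds. (a) Let $m=2k$ with $k\ge1$. The unique positive root of $x^2-(k+1)x-k=0$ is $\beta_f(m)=\frac{k+1+\sqrt{k^2+6k+1}}{2}$,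 and 1. $|W_{\beta,m}|=1$ for $\beta\in(\mathcal G(m),\beta_f(m)]$; 2. $|W_{\beta,m}|=\aleph_0$ for $\beta\in(\beta_f(m),\beta_c(m))$; 3. $|W_{\beta,m}|=2^{\aleph_0}$ for $\beta=\beta_c(m)$; 4. $W_{\beta,m}$ has positive Hausdorff dimension for $\beta\in(\beta_c(m),m+1]$. (b) Let $m=2k+1$ with $k\ge0$. The equation $x^3-(k+2)x^2+x-(k+1)=0$ has a unique real root $\beta_f(m)$, and 1. $|W_{\beta,m}|=2$ for $\beta\in(\mathcal G(m),\beta_f(m)]$; 2. $|W_{\beta,m}|=\aleph_0$ for $\beta\in(\beta_f(m),\beta_c(m))$; 3. $|W_{\beta,m}|=2^{\aleph_0}$ for $\beta=\beta_c(m)$; 4. $W_{\beta,m}$ has positive Hausdorff dimension for $\beta\in(\beta_c(m),m+1]$. -/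

import Mathlib

namespace BetaExp

/-- The set of `β`-expansions of `x` with digits in `{0, …, m}`: sequences `ε₁, ε₂, …` with
`∑_{i ≥ 1} εᵢ / β ^ i = x` (the digit `εᵢ` is stored at the index `i - 1`). -/
def expansions (β : ℝ) (m : ℕ) (x : ℝ) : Set (ℕ → Fin (m + 1)) :=
  {ε | HasSum (fun i : ℕ => ((ε i : ℕ) : ℝ) / β ^ (i + 1)) x}

/-- The points of the open interval `((m + 1 - β) / (β - 1), 1)` with exactly one expansion. -/
def W (β : ℝ) (m : ℕ) : Set ℝ :=
  {x | x ∈ Set.Ioo (((m : ℝ) + 1 - β) / (β - 1)) 1 ∧ (expansions β m x).encard = 1}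

/-- The generalised golden ratio: `k + 1` if `m = 2 * k`, and
`(k + 1 + √(k ^ 2 + 6 * k + 5)) / 2` if `m = 2 * k + 1`. -/
noncomputable def goldenRatio (m : ℕ) : ℝ :=
  let k : ℝ := ((m / 2 : ℕ) : ℝ)
  if Even m then k + 1 else (k + 1 + √(k ^ 2 + 6 * k + 5)) / 2

/-- The Thue–Morse sequence `0, 1, 1, 0, 1, 0, 0, 1, …`. -/
def thueMorse : ℕ → ℤ
  | 0 => 0
  | n + 1 => if Even (n + 1) then thueMorse ((n + 1) / 2) else 1 - thueMorse ((n + 1) / 2)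

theorem thueMorse_zero : thueMorse 0 = 0 := by
  rw [thueMorse]

theorem thueMorse_two_mul (i : ℕ) : thueMorse (2 * i) = thueMorse i := by
  cases i with
  | zero => rfl
  | succ n =>
    rw [show 2 * (n + 1) = (2 * n + 1) + 1 by ring, thueMorse,
      if_pos (by exact ⟨n + 1, by ring⟩)]
    congr 1
    omega

theorem thueMorse_two_mul_add_one (i : ℕ) : thueMorse (2 * i + 1) = 1 - thueMorse i := by
  rw [thueMorse, if_neg (by simp)]
  congr 2
  omega

/-- The digits `λᵢ(m)`, for `i ≥ 1`: `k + λᵢ - λᵢ₋₁` if `m = 2 * k`, and `k + λᵢ` if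
`m = 2 * k + 1`, where `λ` is the Thue–Morse sequence. -/
def lam (m i : ℕ) : ℤ :=
  let k : ℤ := ((m / 2 : ℕ) : ℤ)
  if Even m then k + thueMorse i - thueMorse (i - 1) else k + thueMorse i

/-- `β > 1` solves `∑_{i ≥ 1} λᵢ(m) / β ^ i = 1`. -/
def IsBetaC (m : ℕ) (β : ℝ) : Prop :=
  1 < β ∧ HasSum (fun i : ℕ => (lam m (i + 1) : ℝ) / β ^ (i + 1)) 1

/-- `W β m` has `n` elements for `β ∈ (goldenRatio m, βf]`, is countably infinite for
`β ∈ (βf, βc)`, has the cardinality of the continuum for `β = βc`, and has positive Hausdorff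
dimension for `β ∈ (βc, m + 1]`. -/
def Classification (m n : ℕ) (βf βc : ℝ) : Prop :=
  (∀ β ∈ Set.Ioc (goldenRatio m) βf, Cardinal.mk (W β m) = n) ∧
  (∀ β ∈ Set.Ioo βf βc, Cardinal.mk (W β m) = Cardinal.aleph0) ∧
  Cardinal.mk (W βc m) = Cardinal.continuum ∧
  (∀ β ∈ Set.Ioc βc ((m : ℝ) + 1), 0 < dimH (W β m))

end BetaExp

/-! A point of the interval has one expansion exactly when no digit can be changed by one and the
tail repaired. Hence `W β m` is the injective image of `S β m`, the sequences whose tails all have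
values in the open interval (`W_eq_image`). Reflecting digits reflects this interval, so tail values
are measured from its centre `mid β m`.

The critical sequence is extremal because Thue–Morse is fixed by the substitution `0 ↦ 01`, `1 ↦
10`. In base `β` a substituted sequence has, up to a factor, the values of the original in base `β ^
2` (`tval_subst`). Iterating gives bounds that converge to the value of Thue–Morse from index one
(`tendsto_substBound`). Above `βc`, therefore, `N`-fold substituted sequences give points of `W`
once `N` is large, and a uniformly separated family of them has positive dimension. At `βc` the
shifts of the critical sequence stay in the closed interval; their closure is perfect, and only
countably many of its members touch an endpoint.

Below `βc`, a member of `S` showing the first `2 ^ l` critical digits continues either with the next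
`2 ^ l` critical digits or with the reflected block (`flip_of_begins`). A long critical prefix
already has sum at least one, so the levels `l` are bounded. At the highest level attained the
sequence becomes antiperiodic, and `S` is countable. Up to `βf`, level 0 (even `m`) or level 1 (odd
`m`) is excluded, which leaves the constant sequence or the two alternating ones. Above `βf` an
antiperiodic sequence of that level enters `S`, and prefixing produces infinitely many members. -/

namespace BetaExp

/-! ### Tail values of bounded sequences -/

/-- The value `∑_{i ≥ 1} a_{n+i} / β ^ i` of the `n`-th tail of `a` (indices shifted by one). -/
noncomputable def tval (β : ℝ) (a : ℕ → ℝ) (n : ℕ) : ℝ := ∑' i, a (n + i) / β ^ (i + 1)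

theorem hasSum_geometric_inv {β : ℝ} (hβ : 1 < β) (M : ℝ) :
    HasSum (fun i : ℕ => M / β ^ (i + 1)) (M / (β - 1)) := by
  have h := (hasSum_geometric_of_lt_one (r := β⁻¹) (by positivity)
    (inv_lt_one_of_one_lt₀ hβ)).mul_left (M / β)
  have h1 : β - 1 ≠ 0 := by linarith
  have h2 : β ≠ 0 := by linarith
  have e1 : (fun i : ℕ => M / β ^ (i + 1)) = fun i : ℕ => M / β * β⁻¹ ^ i := by
    funext i
    rw [inv_pow, pow_succ]
    field_simp
  have e2 : M / (β - 1) = M / β * (1 - β⁻¹)⁻¹ := by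
    have : 1 - β⁻¹ = (β - 1) / β := by field_simp
    rw [this]
    field_simp
  rw [e1, e2]
  exact h

theorem summable_tval {β : ℝ} (hβ : 1 < β) {a : ℕ → ℝ} {M : ℝ} (ha : ∀ i, |a i| ≤ M) (n : ℕ) :
    Summable (fun i => a (n + i) / β ^ (i + 1)) := by
  refine Summable.of_norm_bounded (hasSum_geometric_inv hβ M).summable fun i => ?_
  have : (0 : ℝ) < β ^ (i + 1) := by positivity
  rw [Real.norm_eq_abs, abs_div, abs_of_pos this]
  gcongr
  exact ha _

theorem abs_tval_le {β : ℝ} (hβ : 1 < β) {a : ℕ → ℝ} {M : ℝ} (ha : ∀ i, |a i| ≤ M) (n : ℕ) :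
    |tval β a n| ≤ M / (β - 1) := by
  rw [← Real.norm_eq_abs]
  refine tsum_of_norm_bounded (hasSum_geometric_inv hβ M) fun i => ?_
  have : (0 : ℝ) < β ^ (i + 1) := by positivity
  rw [Real.norm_eq_abs, abs_div, abs_of_pos this]
  gcongr
  exact ha _

theorem tval_rec {β : ℝ} (hβ : 1 < β) {a : ℕ → ℝ} {M : ℝ} (ha : ∀ i, |a i| ≤ M) (n : ℕ) :
    tval β a n = (a n + tval β a (n + 1)) / β := by
  have h2 : β ≠ 0 := by linarith
  rw [tval, (summable_tval hβ ha n).tsum_eq_zero_add, tval, add_div, ← tsum_div_const]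
  congr 1
  · simp
  · refine tsum_congr fun i => ?_
    rw [show n + (i + 1) = n + 1 + i by ring, pow_succ β (i + 1)]
    field_simp

/-- Two bounded solutions of the tail recursion coincide. -/
theorem eq_of_bounded_rec {β : ℝ} (hβ : 1 < β) {a u v : ℕ → ℝ} {C D : ℝ} (hu : ∀ i, |u i| ≤ C)
    (hv : ∀ i, |v i| ≤ D) (hru : ∀ n, u n = (a n + u (n + 1)) / β)
    (hrv : ∀ n, v n = (a n + v (n + 1)) / β) (n : ℕ) : u n = v n := by
  have h2 : 0 < β := by linarith
  have key : ∀ j, |u n - v n| ≤ (C + D) * β⁻¹ ^ j := by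
    intro j
    have : u n - v n = (u (n + j) - v (n + j)) * β⁻¹ ^ j := by
      induction j with
      | zero => simp
      | succ j ih =>
        rw [ih, hru (n + j), hrv (n + j), pow_succ, add_assoc]
        field_simp
        ring
    rw [this, abs_mul, abs_of_pos (by positivity : 0 < β⁻¹ ^ j)]
    gcongr
    calc |u (n + j) - v (n + j)| ≤ |u (n + j)| + |v (n + j)| := abs_sub _ _
      _ ≤ C + D := add_le_add (hu _) (hv _)
  have hlim : Filter.Tendsto (fun j : ℕ => (C + D) * β⁻¹ ^ j) Filter.atTop (nhds 0) := by
    simpa using (tendsto_pow_atTop_nhds_zero_of_lt_one (by positivity)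
      (inv_lt_one_of_one_lt₀ hβ)).const_mul (C + D)
  have := ge_of_tendsto' hlim key
  exact sub_eq_zero.mp (abs_nonpos_iff.mp this)

/-- The tool for evaluating tails: a bounded candidate only has to satisfy the recursion, and no
series is rearranged. -/
theorem tval_eq_of_rec {β : ℝ} (hβ : 1 < β) {a u : ℕ → ℝ} {M C : ℝ} (ha : ∀ i, |a i| ≤ M)
    (hu : ∀ i, |u i| ≤ C) (hru : ∀ n, u n = (a n + u (n + 1)) / β) (n : ℕ) :
    tval β a n = u n :=
  eq_of_bounded_rec hβ (abs_tval_le hβ ha) hu (tval_rec hβ ha) hru n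

theorem tval_nonneg {β : ℝ} (hβ : 1 < β) {a : ℕ → ℝ} (ha : ∀ i, 0 ≤ a i) (n : ℕ) :
    0 ≤ tval β a n :=
  tsum_nonneg fun i => div_nonneg (ha _) (by positivity)

theorem tval_shift (β : ℝ) (a : ℕ → ℝ) (p n : ℕ) :
    tval β (fun i => a (p + i)) n = tval β a (p + n) := by
  simp [tval, add_assoc]

/-- Tail values of two sequences that agree on the first `n` entries. -/
theorem tval_sub_of_agree {β : ℝ} (hβ : 1 < β) {a b : ℕ → ℝ} {M : ℝ} (ha : ∀ i, |a i| ≤ M)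
    (hb : ∀ i, |b i| ≤ M) (p q n : ℕ) (h : ∀ i < n, a (p + i) = b (q + i)) :
    tval β a p - tval β b q = (tval β a (p + n) - tval β b (q + n)) / β ^ n := by
  have h2 : β ≠ 0 := by linarith
  induction n with
  | zero => simp
  | succ n ih =>
    rw [ih fun i hi => h i (by omega), tval_rec hβ ha (p + n), tval_rec hβ hb (q + n),
      h n (by omega), pow_succ, add_assoc, add_assoc]
    field_simp
    ring

/-! ### Unique expansions and sequences with all tails in the interval -/

/-- The digits of `ε` as real numbers. -/
def dg {m : ℕ} (ε : ℕ → Fin (m + 1)) (i : ℕ) : ℝ := ((ε i : ℕ) : ℝ)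

theorem dg_nonneg {m : ℕ} (ε : ℕ → Fin (m + 1)) (i : ℕ) : 0 ≤ dg ε i := Nat.cast_nonneg _

theorem dg_le {m : ℕ} (ε : ℕ → Fin (m + 1)) (i : ℕ) : dg ε i ≤ m := by
  have := (ε i).is_lt
  exact Nat.cast_le.mpr (Nat.lt_succ_iff.mp this)

theorem abs_dg_le {m : ℕ} (ε : ℕ → Fin (m + 1)) (i : ℕ) : |dg ε i| ≤ m := by
  rw [abs_of_nonneg (dg_nonneg ε i)]
  exact dg_le ε i

theorem tval_dg_le {β : ℝ} (hβ : 1 < β) {m : ℕ} (ε : ℕ → Fin (m + 1)) (n : ℕ) :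
    tval β (dg ε) n ≤ m / (β - 1) :=
  (le_abs_self _).trans (abs_tval_le hβ (abs_dg_le ε) n)

theorem mem_expansions_iff {β : ℝ} (hβ : 1 < β) {m : ℕ} {x : ℝ} {ε : ℕ → Fin (m + 1)} :
    ε ∈ expansions β m x ↔ tval β (dg ε) 0 = x := by
  have h := (summable_tval hβ (abs_dg_le ε) 0)
  simp only [expansions, Set.mem_ofPred_eq, tval]
  rw [← h.hasSum_iff]
  simp [dg]

/-- Every point of `[0, m / (β - 1)]` has an expansion. -/
theorem exists_expansion {β : ℝ} (hβ : 1 < β) {m : ℕ} (hm : β ≤ m + 1) {x : ℝ} (h0 : 0 ≤ x)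
    (h1 : x ≤ m / (β - 1)) : ∃ ε : ℕ → Fin (m + 1), tval β (dg ε) 0 = x := by
  have hb : 0 < β - 1 := by linarith
  -- Greedy digits capped at `m`. The remainder stays in `[0, m / (β - 1)]`; when the cap is
  -- inactive it is below `1 ≤ m / (β - 1)`.
  let d : ℝ → Fin (m + 1) := fun z => Fin.ofNat (m + 1) (min m ⌊β * z⌋₊)
  have hd : ∀ z, ((d z : ℕ) : ℝ) = min (m : ℝ) (⌊β * z⌋₊ : ℝ) := fun z => by
    have : (d z : ℕ) = min m ⌊β * z⌋₊ := by
      simp only [d, Fin.ofNat]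
      exact Nat.mod_eq_of_lt (by omega)
    rw [this]; push_cast; rfl
  let f : ℝ → ℝ := fun z => β * z - (d z : ℕ)
  let u : ℕ → ℝ := fun n => f^[n] x
  have hf : ∀ z, 0 ≤ z → z ≤ m / (β - 1) → 0 ≤ f z ∧ f z ≤ m / (β - 1) := by
    intro z hz hz'
    have hz0 : 0 ≤ β * z := by positivity
    have hfl := Nat.floor_le hz0
    have hlt := Nat.lt_floor_add_one (β * z)
    simp only [f, hd]
    refine ⟨?_, ?_⟩
    · have := min_le_right (m : ℝ) (⌊β * z⌋₊ : ℝ)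
      linarith
    · rcases le_total (m : ℝ) (⌊β * z⌋₊ : ℝ) with h | h
      · rw [min_eq_left h]
        rw [le_div_iff₀ hb] at hz' ⊢
        nlinarith
      · rw [min_eq_right h]
        have : 1 ≤ (m : ℝ) / (β - 1) := by rw [le_div_iff₀ hb]; linarith
        linarith
  have hu : ∀ n, 0 ≤ u n ∧ u n ≤ m / (β - 1) := by
    intro n
    induction n with
    | zero => exact ⟨h0, h1⟩
    | succ n ih =>
      simp only [u, Function.iterate_succ_apply']
      exact hf _ ih.1 ih.2
  refine ⟨fun n => d (u n), ?_⟩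
  refine tval_eq_of_rec hβ (abs_dg_le _) (u := u) (C := m / (β - 1)) (fun i => ?_) (fun n => ?_) 0
  · rw [abs_of_nonneg (hu i).1]; exact (hu i).2
  · have : u (n + 1) = β * u n - (d (u n) : ℕ) := by
      simp only [u, Function.iterate_succ_apply']; rfl
    rw [this, dg]
    field_simp
    ring

/-- The centre of the interval `((m + 1 - β) / (β - 1), 1)`. -/
noncomputable def mid (β : ℝ) (m : ℕ) : ℝ := m / (2 * (β - 1))

/-- The sequences all of whose tails have a value in `((m + 1 - β) / (β - 1), 1)`. -/
def S (β : ℝ) (m : ℕ) : Set (ℕ → Fin (m + 1)) :=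
  {ε | ∀ n, |tval β (dg ε) n - mid β m| < 1 - mid β m}

theorem two_mul_mid {β : ℝ} (hβ : 1 < β) (m : ℕ) : 2 * mid β m = m / (β - 1) := by
  have hb : β - 1 ≠ 0 := by linarith
  rw [mid]; field_simp

theorem left_endpoint {β : ℝ} (hβ : 1 < β) (m : ℕ) :
    ((m : ℝ) + 1 - β) / (β - 1) = 2 * mid β m - 1 := by
  have hb : β - 1 ≠ 0 := by linarith
  rw [mid]; field_simp; ring

theorem mem_Ioo_iff {β : ℝ} (hβ : 1 < β) (m : ℕ) (x : ℝ) :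
    x ∈ Set.Ioo (((m : ℝ) + 1 - β) / (β - 1)) 1 ↔ |x - mid β m| < 1 - mid β m := by
  rw [left_endpoint hβ, abs_lt, Set.mem_Ioo]
  constructor <;> rintro ⟨h1, h2⟩ <;> constructor <;> linarith

/-- A sequence in `S` is the only expansion of its value. -/
theorem eq_of_mem_S {β : ℝ} (hβ : 1 < β) {m : ℕ} {ε ε' : ℕ → Fin (m + 1)}
    (h : ε ∈ S β m) (hv : tval β (dg ε) 0 = tval β (dg ε') 0) : ε' = ε := by
  by_contra hne
  obtain ⟨n, hn, hmin⟩ : ∃ n, ε n ≠ ε' n ∧ ∀ i < n, ε i = ε' i := by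
    have hex : ∃ n, ε n ≠ ε' n := by
      by_contra hcon
      push Not at hcon
      exact hne (funext fun i => (hcon i).symm)
    classical
    exact ⟨Nat.find hex, Nat.find_spec hex, fun i hi => by simpa using Nat.find_min hex hi⟩
  have heq := tval_sub_of_agree hβ (abs_dg_le ε) (abs_dg_le ε') 0 0 n
    (fun i hi => by simp [dg, hmin i hi])
  have hpos : (0 : ℝ) < β ^ n := by positivity
  have hb : 0 < β := by linarith
  rw [hv, sub_self, eq_comm, div_eq_zero_iff] at heq
  have heq := heq.resolve_right hpos.ne'
  simp only [zero_add] at heq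
  rw [tval_rec hβ (abs_dg_le ε), tval_rec hβ (abs_dg_le ε'), ← sub_div, div_eq_zero_iff] at heq
  have heq := heq.resolve_right hb.ne'
  have hs := abs_lt.mp (h (n + 1))
  have h0 := tval_nonneg hβ (dg_nonneg ε') (n + 1)
  have h1 := tval_dg_le hβ ε' (n + 1)
  have h2 := two_mul_mid hβ m
  -- A smaller digit of `ε` forces its next tail to be at least `1`, a larger one forces it to be at
  -- most `2 * mid β m - 1`; both are excluded.
  rcases lt_or_gt_of_ne (fun h => hn (Fin.ext h) : (ε n : ℕ) ≠ (ε' n : ℕ)) with hl | hl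
  · have : dg ε n + 1 ≤ dg ε' n := by simp only [dg]; exact_mod_cast hl
    linarith
  · have : dg ε' n + 1 ≤ dg ε n := by simp only [dg]; exact_mod_cast hl
    linarith

theorem injOn_S {β : ℝ} (hβ : 1 < β) (m : ℕ) :
    Set.InjOn (fun ε : ℕ → Fin (m + 1) => tval β (dg ε) 0) (S β m) :=
  fun _ _ _ h' hv => eq_of_mem_S hβ h' hv.symm

/-- Replacing a digit and the tail after it. -/
theorem tval_splice {β : ℝ} (hβ : 1 < β) {m : ℕ} (ε δ : ℕ → Fin (m + 1)) (n : ℕ)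
    (d : Fin (m + 1)) (h : ((d : ℕ) : ℝ) + tval β (dg δ) 0 = dg ε n + tval β (dg ε) (n + 1)) :
    tval β (dg fun i => if i < n then ε i else if i = n then d else δ (i - (n + 1))) 0 =
      tval β (dg ε) 0 := by
  set η : ℕ → Fin (m + 1) := fun i => if i < n then ε i else if i = n then d else δ (i - (n + 1))
    with hη
  have h1 := tval_sub_of_agree hβ (abs_dg_le η) (abs_dg_le ε) 0 0 n
    (fun i hi => by simp [dg, hη, hi])
  have h2 : tval β (dg η) (n + 1) = tval β (dg δ) 0 := by
    simp only [tval]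
    refine tsum_congr fun i => ?_
    have : η (n + 1 + i) = δ (0 + i) := by
      simp only [hη]
      rw [if_neg (by omega), if_neg (by omega)]
      congr 1; omega
    simp [dg, this]
  have h3 : dg η n = ((d : ℕ) : ℝ) := by simp [dg, hη]
  simp only [zero_add] at h1
  rw [tval_rec hβ (abs_dg_le η) n, tval_rec hβ (abs_dg_le ε) n, h2, h3, h, sub_self,
    zero_div] at h1
  linarith

/-- If the next tail leaves the interval on the left, adding one to it and lowering the digit gives
a second expansion; on the right, the digit is raised. -/
theorem W_eq_image {β : ℝ} (hβ : 1 < β) {m : ℕ} (hm : β ≤ m + 1) :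
    W β m = (fun ε : ℕ → Fin (m + 1) => tval β (dg ε) 0) '' S β m := by
  have hb : 0 < β - 1 := by linarith
  have hmid := two_mul_mid hβ m
  have hL : 1 ≤ (m : ℝ) / (β - 1) := by rw [le_div_iff₀ hb]; linarith
  ext x
  simp only [W, Set.mem_ofPred_eq, mem_Ioo_iff hβ, Set.mem_image]
  constructor
  · rintro ⟨hx, hu⟩
    obtain ⟨ε, hε⟩ := Set.encard_eq_one.mp hu
    have hmem : ε ∈ expansions β m x := by rw [hε]; rfl
    rw [mem_expansions_iff hβ] at hmem
    have huniq : ∀ ε' : ℕ → Fin (m + 1), tval β (dg ε') 0 = x → ε' = ε := fun ε' h => by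
      have : ε' ∈ expansions β m x := (mem_expansions_iff hβ).mpr h
      rwa [hε] at this
    refine ⟨ε, fun n => ?_, hmem⟩
    induction n with
    | zero => rw [hmem]; exact hx
    | succ n ih =>
      rw [abs_lt] at ih ⊢
      have hrec := tval_rec hβ (abs_dg_le ε) n
      rw [eq_div_iff (by linarith : β ≠ 0)] at hrec
      have h0 := tval_nonneg hβ (dg_nonneg ε) (n + 1)
      have h1 := tval_dg_le hβ ε (n + 1)
      constructor
      · by_contra hcon
        push Not at hcon
        -- A digit `0` cannot be lowered, but then the tail at `n` is the next tail divided by `β`,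
        -- already left of the interval.
        by_cases hd : (ε n : ℕ) = 0
        · have : dg ε n = 0 := by simp [dg, hd]
          rw [this] at hrec
          nlinarith
        · obtain ⟨δ, hδ⟩ := exists_expansion hβ hm (x := tval β (dg ε) (n + 1) + 1)
            (by linarith) (by linarith)
          have hlt := (ε n).is_lt
          have := tval_splice hβ ε δ n ⟨ε n - 1, by omega⟩ (by
            rw [hδ, dg]
            push_cast [Nat.one_le_iff_ne_zero.mpr hd]
            ring)
          have h4 := congrFun (huniq _ (this.trans hmem)) n
          simp only [lt_irrefl, if_false, if_true] at h4
          have := congrArg Fin.val h4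
          simp only at this
          omega
      · by_contra hcon
        push Not at hcon
        -- A digit `m` cannot be raised, but then `β` times the tail at `n` is at least `m + 1 ≥ β`,
        -- so that tail is already at least `1`.
        by_cases hd : (ε n : ℕ) = m
        · have : dg ε n = m := by simp [dg, hd]
          rw [this] at hrec
          nlinarith
        · obtain ⟨δ, hδ⟩ := exists_expansion hβ hm (x := tval β (dg ε) (n + 1) - 1)
            (by linarith) (by linarith)
          have hlt := (ε n).is_lt
          have := tval_splice hβ ε δ n ⟨ε n + 1, by omega⟩ (by
            rw [hδ, dg]
            push_cast
            ring)
          have h4 := congrFun (huniq _ (this.trans hmem)) n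
          simp only [lt_irrefl, if_false, if_true] at h4
          have := congrArg Fin.val h4
          simp only at this
          omega
  · rintro ⟨ε, hε, rfl⟩
    refine ⟨hε 0, Set.encard_eq_one.mpr ⟨ε, ?_⟩⟩
    ext ε'
    rw [mem_expansions_iff hβ, Set.mem_singleton_iff]
    exact ⟨fun h => eq_of_mem_S hβ hε h.symm, fun h => by rw [h]⟩

theorem mk_W {β : ℝ} (hβ : 1 < β) {m : ℕ} (hm : β ≤ m + 1) :
    Cardinal.mk (W β m) = Cardinal.mk (S β m) := by
  rw [W_eq_image hβ hm, Cardinal.mk_image_eq_of_injOn _ _ (injOn_S hβ m)]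

/-! ### The Thue–Morse substitution and extremality of Thue–Morse -/

/-- The `±1` sequence of a Boolean sequence. -/
def sgn (s : ℕ → Bool) (i : ℕ) : ℝ := if s i then 1 else -1

theorem abs_sgn_le (s : ℕ → Bool) (i : ℕ) : |sgn s i| ≤ 1 := by
  unfold sgn; split <;> simp

/-- The Thue–Morse substitution `0 ↦ 01`, `1 ↦ 10`. -/
def subst (s : ℕ → Bool) (i : ℕ) : Bool := if i % 2 = 0 then s (i / 2) else !s (i / 2)

theorem subst_two_mul (s : ℕ → Bool) (j : ℕ) : subst s (2 * j) = s j := by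
  simp [subst]

theorem subst_two_mul_add_one (s : ℕ → Bool) (j : ℕ) : subst s (2 * j + 1) = !s j := by
  have h : (2 * j + 1) / 2 = j := by omega
  simp [subst, h]

theorem sgn_subst_two_mul (s : ℕ → Bool) (j : ℕ) : sgn (subst s) (2 * j) = sgn s j := by
  simp [sgn, subst_two_mul]

theorem sgn_subst_two_mul_add_one (s : ℕ → Bool) (j : ℕ) :
    sgn (subst s) (2 * j + 1) = -sgn s j := by
  simp only [sgn, subst_two_mul_add_one]
  cases s j <;> simp

theorem one_lt_sq {β : ℝ} (hβ : 1 < β) : 1 < β ^ 2 := by nlinarith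

/-- A block `s, -s` contributes `s * (1 / β - 1 / β ^ 2) = (β - 1) * s / β ^ 2`, a single digit in
base `β ^ 2`. An odd index starts in the middle of a block, whose second sign is split off. -/
theorem tval_subst {β : ℝ} (hβ : 1 < β) (s : ℕ → Bool) (n : ℕ) :
    tval β (sgn (subst s)) n =
      if n % 2 = 0 then (β - 1) * tval (β ^ 2) (sgn s) (n / 2)
      else (-sgn s (n / 2) + (β - 1) * tval (β ^ 2) (sgn s) (n / 2 + 1)) / β := by
  have hsq := one_lt_sq hβ
  have hb : 0 < β - 1 := by linarith
  have hB : ∀ j, |(β - 1) * tval (β ^ 2) (sgn s) j| ≤ (β - 1) * (1 / (β ^ 2 - 1)) := fun j => by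
    rw [abs_mul, abs_of_pos hb]
    exact mul_le_mul_of_nonneg_left (abs_tval_le hsq (abs_sgn_le s) j) hb.le
  have hnn : 0 ≤ (β - 1) * (1 / (β ^ 2 - 1)) := (abs_nonneg _).trans (hB 0)
  refine tval_eq_of_rec hβ (abs_sgn_le _) (u := fun n => if n % 2 = 0 then
    (β - 1) * tval (β ^ 2) (sgn s) (n / 2)
      else (-sgn s (n / 2) + (β - 1) * tval (β ^ 2) (sgn s) (n / 2 + 1)) / β)
    (C := 1 + (β - 1) * (1 / (β ^ 2 - 1))) (fun i => ?_) (fun n => ?_) n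
  · split
    · linarith [hB (i / 2)]
    · rw [abs_div, abs_of_pos (by linarith : 0 < β)]
      refine (div_le_self (abs_nonneg _) hβ.le).trans ((abs_add_le _ _).trans ?_)
      rw [abs_neg]
      exact add_le_add (abs_sgn_le _ _) (hB _)
  · rcases Nat.even_or_odd' n with ⟨j, rfl | rfl⟩
    · have h1 : (2 * j + 1) / 2 = j := by omega
      have h2 : (2 * j + 1) % 2 = 1 := by omega
      have h3 : 2 * j % 2 = 0 := by omega
      have h4 : 2 * j / 2 = j := by omega
      simp only [h1, h2, h3, h4, if_true, one_ne_zero, if_false, sgn_subst_two_mul]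
      rw [tval_rec hsq (abs_sgn_le s) j]
      field_simp
      ring
    · have h1 : (2 * j + 1) / 2 = j := by omega
      have h2 : (2 * j + 1) % 2 = 1 := by omega
      have h3 : (2 * j + 1 + 1) % 2 = 0 := by omega
      have h4 : (2 * j + 1 + 1) / 2 = j + 1 := by omega
      simp only [h1, h2, h3, h4, if_true, one_ne_zero, if_false, sgn_subst_two_mul_add_one]

/-- A bound for the tail values of `N`-fold substituted sequences. -/
noncomputable def substBound : ℕ → ℝ → ℝ
  | 0, β => 1 / (β - 1)
  | N + 1, β => (1 + (β - 1) * substBound N (β ^ 2)) / β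

theorem substBound_nonneg (N : ℕ) {β : ℝ} (hβ : 1 < β) : 0 ≤ substBound N β := by
  induction N generalizing β with
  | zero => rw [substBound]; exact div_nonneg zero_le_one (by linarith)
  | succ N ih =>
    rw [substBound]
    have := mul_nonneg (by linarith : (0 : ℝ) ≤ β - 1) (ih (one_lt_sq hβ))
    exact div_nonneg (by linarith) (by linarith)

/-- Odd indices give the recursion of `substBound`. Even indices are harmless: their values are at
most `1 / (β + 1)`, below `1 / β`. -/
theorem abs_tval_iterate_subst_le (N : ℕ) {β : ℝ} (hβ : 1 < β) (s : ℕ → Bool) (n : ℕ) :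
    |tval β (sgn (subst^[N] s)) n| ≤ substBound N β := by
  induction N generalizing β n with
  | zero => exact abs_tval_le hβ (abs_sgn_le s) n
  | succ N ih =>
    have hb : 0 < β - 1 := by linarith
    have hsq := one_lt_sq hβ
    have h0 := mul_nonneg hb.le (substBound_nonneg N hsq)
    rw [Function.iterate_succ_apply', tval_subst hβ, substBound]
    split
    · have h1 := abs_tval_le hsq (abs_sgn_le (subst^[N] s)) (n / 2)
      rw [abs_mul, abs_of_pos hb]
      calc (β - 1) * |tval (β ^ 2) (sgn (subst^[N] s)) (n / 2)|
          ≤ (β - 1) * (1 / (β ^ 2 - 1)) := mul_le_mul_of_nonneg_left h1 hb.le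
        _ = 1 / (β + 1) := by
          rw [show β ^ 2 - 1 = (β - 1) * (β + 1) by ring]
          field_simp
        _ ≤ 1 / β := one_div_le_one_div_of_le (by linarith) (by linarith)
        _ ≤ _ := div_le_div_of_nonneg_right (by linarith) (by linarith)
    · rw [abs_div, abs_of_pos (by linarith : 0 < β)]
      refine div_le_div_of_nonneg_right ((abs_add_le _ _).trans ?_) (by linarith)
      rw [abs_neg, abs_mul, abs_of_pos hb]
      exact add_le_add (abs_sgn_le _ _) (mul_le_mul_of_nonneg_left (ih hsq _) hb.le)

theorem tval_iterate_subst_zero (N : ℕ) {β : ℝ} (hβ : 1 < β) :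
    ∃ C : ℝ, 0 < C ∧ ∀ s : ℕ → Bool,
      tval β (sgn (subst^[N] s)) 0 = C * tval (β ^ 2 ^ N) (sgn s) 0 := by
  induction N generalizing β with
  | zero => exact ⟨1, one_pos, fun s => by simp⟩
  | succ N ih =>
    obtain ⟨C, hC, h⟩ := ih (one_lt_sq hβ)
    refine ⟨(β - 1) * C, mul_pos (by linarith) hC, fun s => ?_⟩
    rw [Function.iterate_succ_apply', tval_subst hβ]
    simp only [Nat.zero_mod, if_true, Nat.zero_div]
    rw [h, ← pow_mul, pow_succ' 2 N]
    ring

theorem iterate_subst_zero (N : ℕ) (s : ℕ → Bool) : (subst^[N] s) 0 = s 0 := by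
  induction N with
  | zero => rfl
  | succ N ih => rw [Function.iterate_succ_apply', ← ih]; simp [subst]

theorem thueMorse_eq_zero_or_one (n : ℕ) : thueMorse n = 0 ∨ thueMorse n = 1 := by
  induction n using Nat.strong_induction_on with
  | _ n ih =>
    rcases Nat.even_or_odd' n with ⟨j, rfl | rfl⟩
    · rcases Nat.eq_zero_or_pos j with rfl | hj
      · exact Or.inl thueMorse_zero
      · rw [thueMorse_two_mul]; exact ih j (by omega)
    · rw [thueMorse_two_mul_add_one]
      rcases ih j (by omega) with h | h <;> simp [h]

/-- The Thue–Morse sequence as a Boolean sequence. -/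
def tm (i : ℕ) : Bool := decide (thueMorse i = 1)

theorem thueMorse_eq_toNat (i : ℕ) : thueMorse i = ((tm i).toNat : ℤ) := by
  rcases thueMorse_eq_zero_or_one i with h | h <;> simp [tm, h]

theorem tm_zero : tm 0 = false := by simp [tm, thueMorse_zero]

theorem tm_two_mul (i : ℕ) : tm (2 * i) = tm i := by simp [tm, thueMorse_two_mul]

theorem tm_two_mul_add_one (i : ℕ) : tm (2 * i + 1) = !tm i := by
  rcases thueMorse_eq_zero_or_one i with h | h <;> simp [tm, thueMorse_two_mul_add_one, h]

theorem subst_tm : subst tm = tm := by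
  funext n
  rcases Nat.even_or_odd' n with ⟨j, rfl | rfl⟩
  · rw [subst_two_mul, tm_two_mul]
  · rw [subst_two_mul_add_one, tm_two_mul_add_one]

theorem iterate_subst_tm (N : ℕ) : subst^[N] tm = tm :=
  Function.iterate_fixed subst_tm N

/-- The value of the Thue–Morse sequence from index `1` on, with digits `±1`. -/
noncomputable def tmVal (β : ℝ) : ℝ := tval β (sgn tm) 1

theorem sgn_tm_zero : sgn tm 0 = -1 := by simp [sgn, tm_zero]

theorem tmVal_rec {β : ℝ} (hβ : 1 < β) : tmVal β = (1 + (β - 1) * tmVal (β ^ 2)) / β := by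
  have h := tval_subst hβ tm 1
  rw [subst_tm] at h
  rw [tmVal, h]
  norm_num [sgn_tm_zero, tmVal]

/-- Both quantities obey the same recursion, which multiplies the error at `β ^ 2` by `(β - 1) / β`.
-/
theorem abs_substBound_sub_tmVal_le (N : ℕ) {β : ℝ} (hβ : 1 < β) :
    |substBound N β - tmVal β| ≤ 2 / (β - 1) * β⁻¹ ^ N := by
  induction N generalizing β with
  | zero =>
    have h := abs_tval_le hβ (abs_sgn_le tm) 1
    have h1 : |1 / (β - 1)| = 1 / (β - 1) := abs_of_pos (by
      have : 0 < β - 1 := by linarith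
      positivity)
    rw [substBound, tmVal, pow_zero, mul_one]
    refine (abs_sub _ _).trans ?_
    rw [h1]
    calc 1 / (β - 1) + |tval β (sgn tm) 1| ≤ 1 / (β - 1) + 1 / (β - 1) := by gcongr
      _ = 2 / (β - 1) := by ring
  | succ N ih =>
    have hb : 0 < β - 1 := by linarith
    have hβ0 : 0 < β := by linarith
    have h := ih (one_lt_sq hβ)
    rw [substBound, tmVal_rec hβ, ← sub_div,
      show 1 + (β - 1) * substBound N (β ^ 2) - (1 + (β - 1) * tmVal (β ^ 2)) =
        (β - 1) * (substBound N (β ^ 2) - tmVal (β ^ 2)) by ring, abs_div, abs_mul,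
      abs_of_pos hb, abs_of_pos hβ0]
    have hpow : (β ^ 2)⁻¹ ^ N ≤ β⁻¹ ^ N := by
      have : (β ^ 2)⁻¹ ≤ β⁻¹ := inv_anti₀ hβ0 (by nlinarith)
      gcongr
    calc (β - 1) * |substBound N (β ^ 2) - tmVal (β ^ 2)| / β
        ≤ (β - 1) * (2 / (β ^ 2 - 1) * β⁻¹ ^ N) / β := by
          have : 0 < β ^ 2 - 1 := by nlinarith
          gcongr
          exact h.trans (by gcongr)
      _ = 2 / (β + 1) * β⁻¹ ^ (N + 1) := by
          rw [show β ^ 2 - 1 = (β - 1) * (β + 1) by ring, pow_succ]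
          field_simp
      _ ≤ 2 / (β - 1) * β⁻¹ ^ (N + 1) := by
          gcongr
          linarith

theorem tendsto_substBound {β : ℝ} (hβ : 1 < β) :
    Filter.Tendsto (fun N => substBound N β) Filter.atTop (nhds (tmVal β)) := by
  rw [tendsto_iff_dist_tendsto_zero]
  refine squeeze_zero (fun _ => dist_nonneg) (fun N => abs_substBound_sub_tmVal_le N hβ) ?_
  simpa using (tendsto_pow_atTop_nhds_zero_of_lt_one (r := β⁻¹) (by positivity)
    (inv_lt_one_of_one_lt₀ hβ)).const_mul (2 / (β - 1))

/-- Thue–Morse is an `N`-fold substituted sequence for every `N`, so all the bounds apply; their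
limit is its own tail at index one. -/
theorem abs_tval_tm_le {β : ℝ} (hβ : 1 < β) (n : ℕ) : |tval β (sgn tm) n| ≤ tmVal β :=
  ge_of_tendsto' (tendsto_substBound hβ) fun N => by
    have := abs_tval_iterate_subst_le N hβ tm n
    rwa [iterate_subst_tm] at this

/-! ### From Boolean sequences to digits -/

/-- The digit sequence of a Boolean sequence: the digits `k + s_{i+1} - s_i` if `m = 2 k`, and
`k + s_{i+1}` if `m = 2 k + 1`. -/
def dig (m : ℕ) (s : ℕ → Bool) (i : ℕ) : Fin (m + 1) :=
  Fin.ofNat (m + 1) (if Even m then m / 2 + (s (i + 1)).toNat - (s i).toNat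
    else m / 2 + (s (i + 1)).toNat)

/-- Neither truncated subtraction nor reduction modulo `m + 1` takes effect: an even `m ≥ 1` has `m
/ 2 ≥ 1`. -/
theorem dig_val {m : ℕ} (hm : 1 ≤ m) (s : ℕ → Bool) (i : ℕ) :
    ((dig m s i : ℕ) : ℤ) = if Even m then ((m / 2 : ℕ) : ℤ) + (s (i + 1)).toNat - (s i).toNat
      else ((m / 2 : ℕ) : ℤ) + (s (i + 1)).toNat := by
  have h1 := Bool.toNat_le (s (i + 1))
  have h2 := Bool.toNat_le (s i)
  simp only [dig, Fin.ofNat]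
  split
  · rename_i he
    obtain ⟨k, rfl⟩ := he
    rw [Nat.mod_eq_of_lt (by omega)]
    omega
  · rename_i he
    rw [Nat.mod_eq_of_lt (by grind)]
    omega

theorem sgn_eq_toNat (s : ℕ → Bool) (i : ℕ) : sgn s i = 2 * (s i).toNat - 1 := by
  unfold sgn
  cases s i <;> norm_num

theorem dg_dig {m : ℕ} (hm : 1 ≤ m) (s : ℕ → Bool) (i : ℕ) :
    dg (dig m s) i = if Even m then (m : ℝ) / 2 + (sgn s (i + 1) - sgn s i) / 2
      else (m : ℝ) / 2 + sgn s (i + 1) / 2 := by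
  have h := dig_val hm s i
  have hd : dg (dig m s) i = (((dig m s i : ℕ) : ℤ) : ℝ) := by simp [dg]
  rw [hd, h, sgn_eq_toNat, sgn_eq_toNat]
  split
  · rename_i he
    obtain ⟨k, rfl⟩ := he
    have : (k + k) / 2 = k := by omega
    rw [this]
    push_cast
    ring
  · rename_i he
    obtain ⟨k, rfl⟩ := Nat.not_even_iff_odd.mp he
    have : (2 * k + 1) / 2 = k := by omega
    rw [this]
    push_cast
    ring

theorem tval_dig {β : ℝ} (hβ : 1 < β) {m : ℕ} (hm : 1 ≤ m) (s : ℕ → Bool) (n : ℕ) :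
    tval β (dg (dig m s)) n = mid β m +
      if Even m then (tval β (sgn s) (n + 1) - tval β (sgn s) n) / 2
      else tval β (sgn s) (n + 1) / 2 := by
  have hb : 0 < β - 1 := by linarith
  have hB := abs_tval_le hβ (abs_sgn_le s)
  have hnn : 0 ≤ 1 / (β - 1) := by positivity
  refine tval_eq_of_rec hβ (abs_dg_le _) (u := fun n => mid β m +
      if Even m then (tval β (sgn s) (n + 1) - tval β (sgn s) n) / 2
      else tval β (sgn s) (n + 1) / 2) (C := |mid β m| + 1 / (β - 1))
    (fun i => (abs_add_le _ _).trans (add_le_add le_rfl ?_)) (fun n => ?_) n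
  · have h1 := abs_le.mp (hB i)
    have h2 := abs_le.mp (hB (i + 1))
    rw [abs_le]
    split <;> constructor <;> linarith
  · have h1 := tval_rec hβ (abs_sgn_le s) n
    have h2 := tval_rec hβ (abs_sgn_le s) (n + 1)
    simp only [dg_dig hm]
    rw [eq_div_iff (by linarith)] at h1 h2 ⊢
    have h3 : mid β m * (β - 1) = m / 2 := by rw [mid]; field_simp
    split <;> linarith

/-- The bound for the centred tail values of `dig m s` that results from a bound `A` for the tail
values of `s`. -/
noncomputable def digBound (β : ℝ) (m : ℕ) (A : ℝ) : ℝ :=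
  if Even m then ((1 - 1 / β) * A + 1 / β) / 2 else A / 2

theorem abs_tval_dig_le {β : ℝ} (hβ : 1 < β) {m : ℕ} (hm : 1 ≤ m) {s : ℕ → Bool} {A : ℝ}
    (hA : ∀ n, |tval β (sgn s) n| ≤ A) (n : ℕ) :
    |tval β (dg (dig m s)) n - mid β m| ≤ digBound β m A := by
  rw [tval_dig hβ hm, add_sub_cancel_left, digBound]
  have h1 := abs_le.mp (hA (n + 1))
  split
  · have hβ0 : 0 < 1 / β := by positivity
    have hβ1 : 0 ≤ 1 - 1 / β := by
      have : 1 / β < 1 := by rw [div_lt_one (by linarith)]; exact hβ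
      linarith
    have h2 : tval β (sgn s) n = 1 / β * sgn s n + 1 / β * tval β (sgn s) (n + 1) := by
      rw [tval_rec hβ (abs_sgn_le s) n]; ring
    have h3 := abs_le.mp (abs_sgn_le s n)
    have h4 := mul_le_mul_of_nonneg_left h1.1 hβ1
    have h5 := mul_le_mul_of_nonneg_left h1.2 hβ1
    have h6 := mul_le_mul_of_nonneg_left h3.1 hβ0.le
    have h7 := mul_le_mul_of_nonneg_left h3.2 hβ0.le
    rw [h2, abs_le]
    constructor <;> linarith
  · rw [abs_le]
    constructor <;> linarith

/-- The bound of `abs_tval_dig_le` is attained at index zero: the sign there is `-1` and the tail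
after it is the extremal one. -/
theorem tval_dig_tm {β : ℝ} (hβ : 1 < β) {m : ℕ} (hm : 1 ≤ m) :
    tval β (dg (dig m tm)) 0 = mid β m + digBound β m (tmVal β) := by
  rw [tval_dig hβ hm, digBound, tval_rec hβ (abs_sgn_le tm) 0, sgn_tm_zero, tmVal]
  split <;> ring

theorem continuous_digBound (β : ℝ) (m : ℕ) : Continuous (digBound β m) := by
  unfold digBound
  split <;> fun_prop

/-! ### The critical base -/

theorem lam_eq {m : ℕ} (hm : 1 ≤ m) (i : ℕ) :
    (lam m (i + 1) : ℝ) = dg (dig m tm) i := by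
  have h := dig_val hm tm i
  have hd : dg (dig m tm) i = (((dig m tm i : ℕ) : ℤ) : ℝ) := by simp [dg]
  rw [hd, h, lam]
  simp only [thueMorse_eq_toNat, Nat.add_sub_cancel]

theorem isBetaC_iff {m : ℕ} (hm : 1 ≤ m) {β : ℝ} :
    IsBetaC m β ↔ 1 < β ∧ tval β (dg (dig m tm)) 0 = 1 := by
  refine and_congr_right fun hβ => ?_
  have h := summable_tval hβ (abs_dg_le (dig m tm)) 0
  rw [tval, ← h.hasSum_iff]
  simp [lam_eq hm]

theorem tval_lt_tval {β : ℝ} (hβ : 1 < β) {a b : ℕ → ℝ} {M : ℝ} (ha : ∀ i, |a i| ≤ M)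
    (hb : ∀ i, |b i| ≤ M) (h : ∀ i, a i ≤ b i) {j : ℕ} (hj : a j < b j) :
    tval β a 0 < tval β b 0 := by
  refine Summable.tsum_lt_tsum (i := j) (fun i => ?_) ?_ (summable_tval hβ ha 0)
    (summable_tval hβ hb 0)
  · have : (0 : ℝ) < β ^ (i + 1) := by positivity
    exact div_le_div_of_nonneg_right (h _) this.le
  · have : (0 : ℝ) < β ^ (j + 1) := by positivity
    rw [zero_add]
    exact div_lt_div_of_pos_right hj this

theorem tval_lt_of_lt {β γ : ℝ} (hβ : 1 < β) (hγ : β < γ) {a : ℕ → ℝ} {M : ℝ}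
    (ha : ∀ i, |a i| ≤ M) (h0 : ∀ i, 0 ≤ a i) {j : ℕ} (hj : 0 < a j) :
    tval γ a 0 < tval β a 0 := by
  refine Summable.tsum_lt_tsum (i := j) (fun i => ?_) ?_ (summable_tval (hβ.trans hγ) ha 0)
    (summable_tval hβ ha 0)
  · refine div_le_div_of_nonneg_left (h0 _) (by positivity) ?_
    gcongr
  · rw [zero_add]
    refine div_lt_div_of_pos_left hj (by positivity) ?_
    gcongr

/-- The sum of the first `n` terms bounds the value of a nonnegative sequence from below. -/
theorem sum_le_tval {β : ℝ} (hβ : 1 < β) {a : ℕ → ℝ} {M : ℝ}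
    (ha : ∀ i, |a i| ≤ M) (h0 : ∀ i, 0 ≤ a i) (p n : ℕ) :
    ∑ i ∈ Finset.range n, a (p + i) / β ^ (i + 1) ≤ tval β a p :=
  (summable_tval hβ ha p).sum_le_tsum _ fun i _ => div_nonneg (h0 _) (by positivity)

theorem continuousOn_tval {a : ℕ → ℝ} {M : ℝ} (ha : ∀ i, |a i| ≤ M) {b : ℝ} (hb : 1 < b) :
    ContinuousOn (fun β => tval β a 0) (Set.Ici b) := by
  refine continuousOn_tsum (u := fun i => M / b ^ (i + 1)) (fun i => ?_)
    (hasSum_geometric_inv hb M).summable fun i x hx => ?_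
  · refine continuousOn_const.div (by fun_prop) fun x hx => ?_
    have hx : b ≤ x := hx
    have : 0 < x := by linarith
    positivity
  · have hx : b ≤ x := hx
    have hx0 : 0 < x := by linarith
    have : (0 : ℝ) < x ^ (i + 1) := by positivity
    rw [Real.norm_eq_abs, abs_div, abs_of_pos this]
    have hM : 0 ≤ M := (abs_nonneg _).trans (ha 0)
    gcongr
    exact ha _

theorem tm_one : tm 1 = true := by simpa [tm_zero] using tm_two_mul_add_one 0

theorem tm_two : tm 2 = true := by simpa [tm_one] using tm_two_mul 1

theorem tm_three : tm 3 = false := by simpa [tm_one] using tm_two_mul_add_one 1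

theorem tm_four : tm 4 = true := by simpa [tm_two] using tm_two_mul 2

theorem dg_dig_tm_zero {m : ℕ} (hm : 1 ≤ m) : dg (dig m tm) 0 = ((m / 2 : ℕ) : ℝ) + 1 := by
  have h := dig_val hm tm 0
  simp only [zero_add, tm_one, tm_zero] at h
  have : (dig m tm 0 : ℕ) = m / 2 + 1 := by
    split at h <;> simp at h <;> omega
  rw [dg, this]
  push_cast
  ring

theorem dg_dig_tm_two_lt {m : ℕ} (hm : 1 ≤ m) : dg (dig m tm) 2 < m := by
  have h := dig_val hm tm 2
  simp only [Nat.reduceAdd, tm_two, tm_three] at h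
  have : (dig m tm 2 : ℕ) < m := by
    split at h <;> simp at h <;> omega
  exact Nat.cast_lt.mpr this

theorem tval_dig_tm_lt {m : ℕ} (hm : 1 ≤ m) {β γ : ℝ} (hβ : 1 < β) (hγ : β < γ) :
    tval γ (dg (dig m tm)) 0 < tval β (dg (dig m tm)) 0 :=
  tval_lt_of_lt hβ hγ (abs_dg_le _) (dg_nonneg _) (j := 0) (by
    rw [dg_dig_tm_zero hm]; positivity)

/-- In base `m + 1` the constant sequence `m` has value one, and the critical sequence has a smaller
digit at index two. -/
theorem tval_dig_tm_at_card_lt {m : ℕ} (hm : 1 ≤ m) :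
    tval ((m : ℝ) + 1) (dg (dig m tm)) 0 < 1 := by
  have hm0 : (1 : ℝ) ≤ m := by exact_mod_cast hm
  have hβ : (1 : ℝ) < (m : ℝ) + 1 := by linarith
  have h1 : tval ((m : ℝ) + 1) (fun _ => (m : ℝ)) 0 = 1 := by
    rw [tval, (hasSum_geometric_inv hβ (m : ℝ)).tsum_eq]
    rw [add_sub_cancel_right, div_self (by linarith)]
  exact (tval_lt_tval hβ (M := m) (abs_dg_le _) (fun i => by simp) (dg_le _)
    (dg_dig_tm_two_lt hm)).trans_eq h1

theorem lt_of_isBetaC {m : ℕ} (hm : 1 ≤ m) {β : ℝ} (h : IsBetaC m β) : β < m + 1 := by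
  rw [isBetaC_iff hm] at h
  have h1 := tval_dig_tm_at_card_lt hm
  have hm0 : (1 : ℝ) ≤ m := by exact_mod_cast hm
  by_contra hcon
  push Not at hcon
  rcases hcon.eq_or_lt with he | hlt
  · rw [he, h.2] at h1
    exact lt_irrefl _ h1
  · have := tval_dig_tm_lt hm (by linarith) hlt
    linarith [h.2]

theorem existsUnique_isBetaC {m : ℕ} (hm : 1 ≤ m) : ∃! β : ℝ, IsBetaC m β := by
  have hm0 : (1 : ℝ) ≤ m := by exact_mod_cast hm
  -- Two digits suffice at `10 / 7`; the tightest case is `m = 1`, where they give `7 / 10 + 49 /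
  -- 100`.
  have hlow : 1 ≤ tval (10 / 7) (dg (dig m tm)) 0 := by
    have h := sum_le_tval (β := 10 / 7) (by norm_num) (abs_dg_le (dig m tm)) (dg_nonneg _) 0 2
    refine le_trans ?_ h
    simp only [Finset.sum_range_succ, Finset.sum_range_zero, zero_add]
    rw [dg_dig_tm_zero hm]
    rcases Nat.even_or_odd' m with ⟨k, rfl | rfl⟩
    · have h1 : (2 * k) / 2 = k := by omega
      have h2 : (1 : ℝ) ≤ k := by exact_mod_cast (by omega : 1 ≤ k)
      have h3 := dg_nonneg (dig (2 * k) tm) 1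
      rw [h1]
      norm_num
      linarith
    · have h1 : (2 * k + 1) / 2 = k := by omega
      have h2 : (0 : ℝ) ≤ k := Nat.cast_nonneg k
      have h3 : (k : ℝ) + 1 ≤ dg (dig (2 * k + 1) tm) 1 := by
        rw [dg_dig hm, if_neg (by simp)]
        simp [sgn, tm_two]
        linarith
      rw [h1]
      norm_num
      linarith
  have hhigh := tval_dig_tm_at_card_lt hm
  have hle : (10 / 7 : ℝ) ≤ m + 1 := by linarith
  have hc : ContinuousOn (fun β => tval β (dg (dig m tm)) 0) (Set.Icc (10 / 7) ((m : ℝ) + 1)) :=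
    (continuousOn_tval (abs_dg_le _) (by norm_num)).mono fun x hx => hx.1
  obtain ⟨β, hβ, hβ1⟩ := intermediate_value_Icc' hle hc ⟨hhigh.le, hlow⟩
  have hβ' : 1 < β := by linarith [hβ.1]
  refine ⟨β, (isBetaC_iff hm).mpr ⟨hβ', hβ1⟩, fun γ hγ => ?_⟩
  obtain ⟨hγ, hγ1⟩ := (isBetaC_iff hm).mp hγ
  simp only at hβ1
  rcases lt_trichotomy γ β with h | h | h
  · have := tval_dig_tm_lt hm hγ h; linarith
  · exact h
  · have := tval_dig_tm_lt hm hβ' h; linarith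

/-! ### Positive dimension above the critical base -/

/-- A uniformly separated coding of a set by Boolean sequences makes its dimension positive. -/
theorem dimH_range_pos_of_separated {f : (ℕ → Bool) → ℝ} {C z : ℝ} (hC : 0 < C) (hz : 0 < z)
    (hz1 : z < 1) (hf : ∀ s t : ℕ → Bool, ∀ n, (∀ i < n, s i = t i) → s n ≠ t n →
      C * z ^ n ≤ |f s - f t|) : 0 < dimH (Set.range f) := by
  let b : (ℕ → Bool) → ℕ → ℝ := fun s i => (s i).toNat
  have hb0 : ∀ s i, 0 ≤ b s i := fun s i => Nat.cast_nonneg _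
  have hb1 : ∀ s i, |b s i| ≤ 1 := fun s i => by
    rw [abs_of_nonneg (hb0 s i)]
    exact Nat.cast_le_one.mpr (Bool.toNat_le (s i))
  let bin : (ℕ → Bool) → ℝ := fun s => tval 2 (b s) 0
  have hfirst : ∀ s t : ℕ → Bool, s ≠ t → ∃ n, (∀ i < n, s i = t i) ∧ s n ≠ t n := by
    intro s t hst
    have hex : ∃ n, s n ≠ t n := Function.ne_iff.mp hst
    classical
    exact ⟨Nat.find hex, fun i hi => by simpa using Nat.find_min hex hi, Nat.find_spec hex⟩
  have hinj : Function.Injective f := by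
    intro s t hst
    by_contra hne
    obtain ⟨n, hn, hn'⟩ := hfirst s t hne
    have := hf s t n hn hn'
    rw [hst, sub_self, abs_zero] at this
    have : 0 < C * z ^ n := by positivity
    linarith
  -- This exponent gives `z ^ r = 1 / 2`. Decoding a point and reading its code in binary is then
  -- `r`-Hölder with image containing `[0, 1]`, so the range cannot have dimension zero.
  let r : ℝ := Real.log 2 / Real.log z⁻¹
  have hlz : 0 < Real.log z⁻¹ := Real.log_pos ((one_lt_inv₀ hz).mpr hz1)
  have hr : 0 < r := div_pos (Real.log_pos (by norm_num)) hlz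
  have hzr : z ^ r = 1 / 2 := by
    rw [Real.rpow_def_of_pos hz]
    have : Real.log z * r = - Real.log 2 := by
      simp only [r]
      rw [Real.log_inv] at hlz ⊢
      have : Real.log z ≠ 0 := by linarith
      field_simp
    rw [this, Real.exp_neg, Real.exp_log (by norm_num)]
    norm_num
  let g : ℝ → ℝ := fun x => bin (Function.invFun f x)
  have hgf : ∀ s, g (f s) = bin s := fun s => by
    simp only [g, Function.leftInverse_invFun hinj s]
  have hbin : ∀ s t : ℕ → Bool, |bin s - bin t| ≤ 2 * (C⁻¹ ^ r * |f s - f t| ^ r) := by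
    intro s t
    by_cases hst : s = t
    · subst hst
      have : (0 : ℝ) ≤ 2 * (C⁻¹ ^ r * |f s - f s| ^ r) := by positivity
      simpa using this
    obtain ⟨n, hn, hn'⟩ := hfirst s t hst
    have h1 := hf s t n hn hn'
    have h2 := tval_sub_of_agree (β := 2) (by norm_num) (hb1 s) (hb1 t) 0 0 n
      (fun i hi => by simp [b, hn i hi])
    have h3 : |bin s - bin t| ≤ 2 * (1 / 2) ^ n := by
      simp only [bin]
      rw [h2, abs_div, abs_of_pos (by positivity : (0 : ℝ) < 2 ^ n), one_div, inv_pow,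
        ← div_eq_mul_inv]
      gcongr
      have e1 := abs_tval_le (β := 2) (by norm_num) (hb1 s) (0 + n)
      have e2 := abs_tval_le (β := 2) (by norm_num) (hb1 t) (0 + n)
      refine (abs_sub _ _).trans ?_
      norm_num at e1 e2 ⊢
      linarith
    have h4 : ((1 : ℝ) / 2) ^ n = (z ^ n) ^ r := by
      rw [← hzr, ← Real.rpow_natCast, ← Real.rpow_natCast, ← Real.rpow_mul hz.le,
        ← Real.rpow_mul hz.le, mul_comm]
    have h5 : z ^ n ≤ C⁻¹ * |f s - f t| := by
      rw [inv_mul_eq_div, le_div_iff₀ hC]; linarith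
    rw [← Real.mul_rpow (by positivity) (abs_nonneg _)]
    refine h3.trans ?_
    rw [h4]
    gcongr
  have hold : HolderOnWith (Real.toNNReal (2 * C⁻¹ ^ r)) (Real.toNNReal r) g (Set.range f) := by
    rintro _ ⟨s, rfl⟩ _ ⟨t, rfl⟩
    rw [hgf, hgf, edist_dist, edist_dist, Real.dist_eq, Real.dist_eq, Real.coe_toNNReal r hr.le,
      ENNReal.ofReal_rpow_of_nonneg (abs_nonneg _) hr.le,
      show ((2 * C⁻¹ ^ r).toNNReal : ENNReal) = ENNReal.ofReal (2 * C⁻¹ ^ r) from rfl, ← ENNReal.ofReal_mul (by positivity)]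
    · refine ENNReal.ofReal_le_ofReal ((hbin s t).trans (le_of_eq (by ring)))
  have hdim := hold.dimH_image_le (Real.toNNReal_pos.mpr hr)
  have himg : Set.Icc (0 : ℝ) 1 ⊆ g '' Set.range f := by
    intro x hx
    obtain ⟨ε, hε⟩ := exists_expansion (β := 2) (m := 1) (by norm_num) (by norm_num) hx.1
      (by norm_num; exact hx.2)
    refine ⟨f fun i => decide (ε i = 1), ⟨_, rfl⟩, ?_⟩
    rw [hgf, ← hε]
    simp only [bin]
    congr 1
    funext i
    simp only [b, dg]
    generalize ε i = d
    fin_cases d <;> simp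
  have hone : dimH (g '' Set.range f) = 1 := by
    rw [Real.dimH_of_nonempty_interior]
    · simp
    · refine Set.Nonempty.mono (interior_mono himg) ?_
      rw [interior_Icc]
      exact ⟨1 / 2, by norm_num⟩
  rw [hone] at hdim
  by_contra h0
  rw [not_lt, nonpos_iff_eq_zero] at h0
  rw [h0, ENNReal.zero_div] at hdim
  exact absurd hdim (by simp)

theorem dimH_W_pos {m : ℕ} (hm : 1 ≤ m) {βc β : ℝ} (hc : IsBetaC m βc) (h : βc < β)
    (hβm : β ≤ m + 1) : 0 < dimH (W β m) := by
  obtain ⟨hc1, hc2⟩ := (isBetaC_iff hm).mp hc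
  have hβ : 1 < β := hc1.trans h
  have hlt := tval_dig_tm_lt hm hc1 h
  rw [hc2, tval_dig_tm hβ hm] at hlt
  have hlim := (continuous_digBound β m).continuousAt.tendsto.comp (tendsto_substBound hβ)
  have hev := hlim.eventually_lt_const (u := 1 - mid β m) (by linarith)
  have hev2 : ∀ᶠ N : ℕ in Filter.atTop, 3 ≤ β ^ 2 ^ N :=
    ((tendsto_pow_atTop_atTop_of_one_lt hβ).comp
      (tendsto_pow_atTop_atTop_of_one_lt one_lt_two)).eventually_ge_atTop 3
  obtain ⟨N, hN, hN2⟩ := (hev.and hev2).exists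
  obtain ⟨C, hC, hCs⟩ := tval_iterate_subst_zero N hβ
  set γ := β ^ 2 ^ N with hγ
  have hγ1 : 1 < γ := by linarith
  -- A leading `true` fixes the sign at index zero, which makes the tail at index one affine in the
  -- value at index zero, hence in the value in base `γ`.
  let pre : (ℕ → Bool) → ℕ → Bool := fun s i => Nat.casesOn i true s
  let f : (ℕ → Bool) → ℝ := fun s => tval β (dg (dig m (subst^[N] (pre s)))) 0
  have hmemS : ∀ s, dig m (subst^[N] (pre s)) ∈ S β m := fun s n =>
    (abs_tval_dig_le hβ hm (abs_tval_iterate_subst_le N hβ (pre s)) n).trans_lt hN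
  have hsub : Set.range f ⊆ W β m := by
    rintro _ ⟨s, rfl⟩
    rw [W_eq_image hβ hβm]
    exact ⟨_, hmemS s, rfl⟩
  refine lt_of_lt_of_le ?_ (dimH_mono hsub)
  obtain ⟨a, ha, hfa⟩ : ∃ a > 0, ∀ s t, f s - f t =
      a * (tval γ (sgn (pre s)) 0 - tval γ (sgn (pre t)) 0) := by
    have h1 : ∀ s, tval β (sgn (subst^[N] (pre s))) 1 =
        β * (C * tval γ (sgn (pre s)) 0) - 1 := fun s => by
      have h2 := tval_rec hβ (abs_sgn_le (subst^[N] (pre s))) 0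
      have h3 : sgn (subst^[N] (pre s)) 0 = 1 := by
        simp [sgn, iterate_subst_zero, pre]
      rw [eq_div_iff (by linarith), hCs, h3, zero_add] at h2
      linarith
    by_cases he : Even m
    · refine ⟨(β - 1) * C / 2, by have : 0 < β - 1 := by linarith
                                  positivity, fun s t => ?_⟩
      simp only [f, tval_dig hβ hm, if_pos he, zero_add, h1, hCs]
      ring
    · refine ⟨β * C / 2, by positivity, fun s t => ?_⟩
      simp only [f, tval_dig hβ hm, if_neg he, zero_add, h1]
      ring
  refine dimH_range_pos_of_separated (C := a * (1 / γ ^ 2)) (z := γ⁻¹) (by positivity)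
    (by positivity) (inv_lt_one_of_one_lt₀ hγ1) fun s t n hn hne => ?_
  rw [hfa, abs_mul, abs_of_pos ha, mul_assoc]
  refine mul_le_mul_of_nonneg_left ?_ ha.le
  have hag := tval_sub_of_agree hγ1 (abs_sgn_le (pre s)) (abs_sgn_le (pre t)) 0 0 (n + 1)
    (fun i hi => by
      cases i with
      | zero => simp [sgn, pre]
      | succ i => simp [sgn, pre, hn i (by omega)])
  simp only [zero_add] at hag
  rw [hag, tval_rec hγ1 (abs_sgn_le (pre s)), tval_rec hγ1 (abs_sgn_le (pre t)), ← sub_div,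
    div_div, abs_div, abs_of_pos (by positivity : 0 < γ * γ ^ (n + 1))]
  have e1 := abs_le.mp (abs_tval_le hγ1 (abs_sgn_le (pre s)) (n + 1 + 1))
  have e2 := abs_le.mp (abs_tval_le hγ1 (abs_sgn_le (pre t)) (n + 1 + 1))
  -- At the first difference the signs are `2` apart, and `γ ≥ 3` prevents the tails from
  -- compensating more than `1`.
  have e3 : 1 / (γ - 1) ≤ 1 / 2 := one_div_le_one_div_of_le (by norm_num) (by linarith)
  have e4 : 1 ≤ |sgn (pre s) (n + 1) + tval γ (sgn (pre s)) (n + 1 + 1) -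
      (sgn (pre t) (n + 1) + tval γ (sgn (pre t)) (n + 1 + 1))| := by
    have hs : pre s (n + 1) = s n := rfl
    have ht : pre t (n + 1) = t n := rfl
    rcases Bool.eq_false_or_eq_true (s n) with h1 | h1
    · have h2 : t n = false := by simpa [h1] using hne.symm
      have e5 : sgn (pre s) (n + 1) = 1 := by simp [sgn, hs, h1]
      have e6 : sgn (pre t) (n + 1) = -1 := by simp [sgn, ht, h2]
      rw [e5, e6, le_abs]
      left; linarith
    · have h2 : t n = true := by simpa [h1] using hne.symm
      have e5 : sgn (pre s) (n + 1) = -1 := by simp [sgn, hs, h1]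
      have e6 : sgn (pre t) (n + 1) = 1 := by simp [sgn, ht, h2]
      rw [e5, e6, le_abs]
      right; linarith
  have hγ0 : 0 < γ := by linarith
  rw [le_div_iff₀ (by positivity)]
  refine le_trans (le_of_eq ?_) e4
  rw [inv_pow, pow_succ γ n]
  field_simp

/-! ### Reflection, critical blocks and antiperiodicity -/

/-- The reflected digit sequence `m - ε_i`. -/
def refl {m : ℕ} (ε : ℕ → Fin (m + 1)) (i : ℕ) : Fin (m + 1) := (ε i).rev

theorem refl_refl {m : ℕ} (ε : ℕ → Fin (m + 1)) : refl (refl ε) = ε := by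
  funext i; simp [refl]

theorem dg_refl {m : ℕ} (ε : ℕ → Fin (m + 1)) (i : ℕ) : dg (refl ε) i = m - dg ε i := by
  have h := (ε i).is_lt
  have : ((ε i).rev : ℕ) + (ε i : ℕ) = m := by rw [Fin.val_rev]; omega
  have h2 : (((ε i).rev : ℕ) : ℝ) + ((ε i : ℕ) : ℝ) = m := by exact_mod_cast this
  simp only [dg, refl]
  linarith

theorem tval_refl {β : ℝ} (hβ : 1 < β) {m : ℕ} (ε : ℕ → Fin (m + 1)) (n : ℕ) :
    tval β (dg (refl ε)) n = 2 * mid β m - tval β (dg ε) n := by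
  have h := abs_tval_le hβ (abs_dg_le ε)
  refine tval_eq_of_rec hβ (abs_dg_le _) (u := fun n => 2 * mid β m - tval β (dg ε) n)
    (C := |2 * mid β m| + m / (β - 1))
    (fun i => (abs_sub _ _).trans (add_le_add le_rfl (h i))) (fun n => ?_) n
  have h1 := tval_rec hβ (abs_dg_le ε) n
  have hb : 0 < β - 1 := by linarith
  rw [eq_div_iff (by linarith)] at h1 ⊢
  have h3 : mid β m * (β - 1) = m / 2 := by rw [mid]; field_simp
  rw [dg_refl]
  linarith

theorem refl_mem_S {β : ℝ} (hβ : 1 < β) {m : ℕ} {ε : ℕ → Fin (m + 1)} (h : ε ∈ S β m) :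
    refl ε ∈ S β m := fun n => by
  have := h n
  rw [tval_refl hβ]
  rw [abs_lt] at this ⊢
  constructor <;> linarith

/-- Tails of a sequence in `S` are lexicographically at most any sequence of value at least one. -/
theorem le_of_agree {β : ℝ} (hβ : 1 < β) {m : ℕ} {ε δ : ℕ → Fin (m + 1)} (hε : ε ∈ S β m)
    (hδ : 1 ≤ tval β (dg δ) 0) {p i : ℕ} (h : ∀ j < i, ε (p + j) = δ j) : ε (p + i) ≤ δ i := by
  by_contra hcon
  push Not at hcon
  have h1 : dg δ i + 1 ≤ dg ε (p + i) := by
    simp only [dg]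
    exact_mod_cast hcon
  have hag := tval_sub_of_agree hβ (abs_dg_le ε) (abs_dg_le δ) p 0 i
    (fun j hj => by simp [dg, h j hj])
  have h2 := abs_lt.mp (hε (p + i + 1))
  have h3 := tval_dg_le hβ δ (i + 1)
  have h4 := two_mul_mid hβ m
  have h5 := abs_lt.mp (hε p)
  rw [zero_add, tval_rec hβ (abs_dg_le ε) (p + i), tval_rec hβ (abs_dg_le δ) i, ← sub_div,
    div_div] at hag
  have h6 : 0 < (dg ε (p + i) + tval β (dg ε) (p + i + 1) - (dg δ i + tval β (dg δ) (i + 1))) /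
      (β * β ^ i) := div_pos (by linarith) (by positivity)
  linarith

theorem rev_le_of_agree {β : ℝ} (hβ : 1 < β) {m : ℕ} {ε δ : ℕ → Fin (m + 1)} (hε : ε ∈ S β m)
    (hδ : 1 ≤ tval β (dg δ) 0) {p i : ℕ} (h : ∀ j < i, ε (p + j) = (δ j).rev) :
    (δ i).rev ≤ ε (p + i) := by
  have := le_of_agree hβ (refl_mem_S hβ hε) hδ (p := p) (i := i)
    (fun j hj => by simp [refl, h j hj])
  rwa [refl, Fin.rev_le_iff] at this

theorem tm_two_pow_add (l : ℕ) {j : ℕ} (hj : j < 2 ^ l) : tm (2 ^ l + j) = !tm j := by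
  induction l generalizing j with
  | zero =>
    obtain rfl : j = 0 := by simpa using hj
    simp [tm_one, tm_zero]
  | succ l ih =>
    rw [pow_succ'] at hj ⊢
    rcases Nat.even_or_odd' j with ⟨i, rfl | rfl⟩
    · rw [← mul_add, tm_two_mul, tm_two_mul, ih (by omega)]
    · rw [← add_assoc, ← mul_add, tm_two_mul_add_one, tm_two_mul_add_one, ih (by omega)]

theorem tm_two_pow (l : ℕ) : tm (2 ^ l) = true := by
  simpa [tm_zero] using tm_two_pow_add l (j := 0) (by positivity)

theorem toNat_not_cast (b : Bool) : (((!b).toNat : ℕ) : ℤ) = 1 - (b.toNat : ℤ) := by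
  cases b <;> simp

theorem dig_tm_two_pow_add {m : ℕ} (hm : 1 ≤ m) (l : ℕ) {j : ℕ} (hj : j + 1 < 2 ^ l) :
    dig m tm (2 ^ l + j) = (dig m tm j).rev := by
  have h1 := dig_val hm tm (2 ^ l + j)
  have h2 := dig_val hm tm j
  rw [add_assoc, tm_two_pow_add l hj, tm_two_pow_add l (by omega : j < 2 ^ l)] at h1
  simp only [toNat_not_cast] at h1
  apply Fin.ext
  rw [Fin.val_rev]
  have h3 := (dig m tm j).is_lt
  rcases Nat.even_or_odd' m with ⟨k, rfl | rfl⟩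
  · simp only [even_two_mul, if_true] at h1 h2
    omega
  · rw [if_neg (by simp)] at h1 h2
    omega

/-- The last digit of the block reads the bit at `2 ^ (l + 1)`, which is `true` like the bit at `2 ^
l` and not its complement; this is the surplus of one over the reflection. -/
theorem dig_tm_last {m : ℕ} (hm : 1 ≤ m) (l : ℕ) :
    (dig m tm (2 ^ l + (2 ^ l - 1)) : ℕ) = ((dig m tm (2 ^ l - 1)).rev : ℕ) + 1 := by
  have hpos : 0 < 2 ^ l := by positivity
  have h1 := dig_val hm tm (2 ^ l + (2 ^ l - 1))
  have h2 := dig_val hm tm (2 ^ l - 1)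
  rw [show 2 ^ l + (2 ^ l - 1) + 1 = 2 ^ (l + 1) by rw [pow_succ]; omega, tm_two_pow,
    tm_two_pow_add l (by omega : 2 ^ l - 1 < 2 ^ l)] at h1
  rw [Nat.sub_add_cancel hpos, tm_two_pow] at h2
  simp only [toNat_not_cast, Bool.toNat_true] at h1 h2
  rw [Fin.val_rev]
  have h3 := (dig m tm (2 ^ l - 1)).is_lt
  rcases Nat.even_or_odd' m with ⟨k, rfl | rfl⟩
  · simp only [even_two_mul, if_true] at h1 h2
    omega
  · rw [if_neg (by simp)] at h1 h2
    omega

/-- At position `p` the sequence `ε` begins with the first `2 ^ l` critical digits. -/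
def Begins {m : ℕ} (ε : ℕ → Fin (m + 1)) (p l : ℕ) : Prop :=
  ∀ j < 2 ^ l, ε (p + j) = dig m tm j

/-- Comparison from `p` bounds the next digits above by critical digits; comparison from `p + 2 ^ l`
bounds them below by reflected ones. -/
theorem flip_of_begins {β : ℝ} (hβ : 1 < β) {m : ℕ} (hm : 1 ≤ m)
    (h1 : 1 ≤ tval β (dg (dig m tm)) 0) {ε : ℕ → Fin (m + 1)} (hε : ε ∈ S β m) {p l : ℕ}
    (hb : Begins ε p l) (hn : ¬ Begins ε p (l + 1)) :
    ∀ j < 2 ^ l, ε (p + 2 ^ l + j) = (ε (p + j)).rev := by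
  have hagree : ∀ j < 2 ^ l, (∀ i < j, ε (p + 2 ^ l + i) = (dig m tm i).rev) →
      ∀ i < 2 ^ l + j, ε (p + i) = dig m tm i := by
    intro j hj ih i hi
    rcases lt_or_ge i (2 ^ l) with h | h
    · exact hb i h
    · obtain ⟨i, rfl⟩ := Nat.exists_eq_add_of_le h
      rw [← add_assoc, ih i (by omega), dig_tm_two_pow_add hm l (by omega)]
  have key : ∀ j < 2 ^ l, ε (p + 2 ^ l + j) = (dig m tm j).rev := by
    intro j
    induction j using Nat.strong_induction_on with
    | _ j ih =>
      intro hj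
      have ih' : ∀ i < j, ε (p + 2 ^ l + i) = (dig m tm i).rev := fun i hi =>
        ih i hi (by omega)
      have hle := le_of_agree hβ hε h1 (hagree j hj ih')
      have hge := rev_le_of_agree hβ hε h1 ih'
      rw [← add_assoc] at hle
      -- The two bounds coincide before the last digit of the block. There they differ by one, and
      -- the larger choice would complete level `l + 1`.
      rcases Nat.lt_or_ge (j + 1) (2 ^ l) with h | h
      · rw [dig_tm_two_pow_add hm l h] at hle
        exact le_antisymm hle hge
      · obtain rfl : j = 2 ^ l - 1 := by omega
        have hlast := dig_tm_last hm l
        rw [Fin.le_def] at hle hge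
        by_contra hne
        have hne' : (ε (p + 2 ^ l + (2 ^ l - 1)) : ℕ) ≠ ((dig m tm (2 ^ l - 1)).rev : ℕ) :=
          fun h => hne (Fin.ext h)
        refine hn fun i hi => ?_
        rw [pow_succ] at hi
        rcases Nat.lt_or_ge i (2 ^ l + (2 ^ l - 1)) with h | h
        · exact hagree _ hj ih' i h
        · obtain rfl : i = 2 ^ l + (2 ^ l - 1) := by omega
          apply Fin.ext
          rw [← add_assoc]
          omega
  intro j hj
  rw [key j hj, hb j hj]

/-- If the level `l` is attained at `p` and the level `l + 1` nowhere, then `ε` is antiperiodic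
from `p` on. -/
theorem antiperiodic_of_begins {β : ℝ} (hβ : 1 < β) {m : ℕ} (hm : 1 ≤ m)
    (h1 : 1 ≤ tval β (dg (dig m tm)) 0) {ε : ℕ → Fin (m + 1)} (hε : ε ∈ S β m) {p l : ℕ}
    (hb : Begins ε p l) (hn : ∀ q, ¬ Begins ε q (l + 1) ∧ ¬ Begins (refl ε) q (l + 1)) (i : ℕ) :
    ε (p + i + 2 ^ l) = (ε (p + i)).rev := by
  -- The sequence is quantified because the induction passes to the reflected sequence one block
  -- later.
  have key : ∀ q : ℕ, ∀ ε ∈ S β m, ∀ p, Begins ε p l →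
      (∀ q, ¬ Begins ε q (l + 1) ∧ ¬ Begins (refl ε) q (l + 1)) →
      ∀ j < 2 ^ l, ε (p + q * 2 ^ l + 2 ^ l + j) = (ε (p + q * 2 ^ l + j)).rev := by
    intro q
    induction q with
    | zero =>
      intro ε hε p hb hn j hj
      simpa using flip_of_begins hβ hm h1 hε hb (hn p).1 j hj
    | succ q ih =>
      intro ε hε p hb hn j hj
      have hflip := flip_of_begins hβ hm h1 hε hb (hn p).1
      have := ih (refl ε) (refl_mem_S hβ hε) (p + 2 ^ l)
        (fun j hj => by rw [refl, hflip j hj, hb j hj, Fin.rev_rev])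
        (fun q => by rw [refl_refl]; exact (hn q).symm) j hj
      simp only [refl, Fin.rev_inj] at this
      rw [show p + (q + 1) * 2 ^ l + 2 ^ l + j = p + 2 ^ l + q * 2 ^ l + 2 ^ l + j by ring,
        show p + (q + 1) * 2 ^ l + j = p + 2 ^ l + q * 2 ^ l + j by ring, this]
  have := key (i / 2 ^ l) ε hε p hb hn (i % 2 ^ l) (Nat.mod_lt _ (by positivity))
  have hdiv := Nat.div_add_mod' i (2 ^ l)
  rw [show p + i / 2 ^ l * 2 ^ l + 2 ^ l + i % 2 ^ l =
      p + (i / 2 ^ l * 2 ^ l + i % 2 ^ l) + 2 ^ l by ring,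
    add_assoc p (i / 2 ^ l * 2 ^ l), hdiv] at this
  exact this

theorem not_begins {β : ℝ} (hβ : 1 < β) {m : ℕ} {ε : ℕ → Fin (m + 1)} (hε : ε ∈ S β m) {N : ℕ}
    (hN : 1 ≤ ∑ i ∈ Finset.range (2 ^ N), dg (dig m tm) i / β ^ (i + 1)) (p : ℕ) :
    ¬ Begins ε p N := by
  intro hb
  have h1 := sum_le_tval hβ (abs_dg_le ε) (dg_nonneg ε) p (2 ^ N)
  have h2 := (abs_lt.mp (hε p)).2
  have h3 : ∑ i ∈ Finset.range (2 ^ N), dg ε (p + i) / β ^ (i + 1) =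
      ∑ i ∈ Finset.range (2 ^ N), dg (dig m tm) i / β ^ (i + 1) :=
    Finset.sum_congr rfl fun i hi => by
      rw [dg, hb i (Finset.mem_range.mp hi)]; rfl
  linarith

theorem begins_zero_iff {m : ℕ} (hm : 1 ≤ m) {ε : ℕ → Fin (m + 1)} {p : ℕ} :
    Begins ε p 0 ↔ (ε p : ℕ) = m / 2 + 1 := by
  have h : (dig m tm 0 : ℕ) = m / 2 + 1 := by
    have := dg_dig_tm_zero hm
    simp only [dg] at this
    exact_mod_cast this
  simp only [Begins, pow_zero, Nat.lt_one_iff, forall_eq, add_zero, Fin.ext_iff, h]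

theorem digit_bounds {β : ℝ} (hβ : 1 < β) {m : ℕ} (hm : 1 ≤ m)
    (h1 : 1 ≤ tval β (dg (dig m tm)) 0) {ε : ℕ → Fin (m + 1)} (hε : ε ∈ S β m) (p : ℕ) :
    (ε p : ℕ) ≤ m / 2 + 1 ∧ m ≤ (ε p : ℕ) + (m / 2 + 1) := by
  have h : (dig m tm 0 : ℕ) = m / 2 + 1 := by
    have := dg_dig_tm_zero hm
    simp only [dg] at this
    exact_mod_cast this
  have h2 := le_of_agree hβ hε h1 (p := p) (i := 0) (by simp)
  have h3 := rev_le_of_agree hβ hε h1 (p := p) (i := 0) (by simp)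
  rw [Fin.le_def, add_zero] at h2 h3
  rw [Fin.val_rev] at h3
  omega

/-! ### Countability below the critical base -/

theorem countable_eventually_periodic {α : Type*} [Finite α] :
    {f : ℕ → α | ∃ p q, 0 < q ∧ ∀ i, f (p + i + q) = f (p + i)}.Countable := by
  have : {f : ℕ → α | ∃ p q, 0 < q ∧ ∀ i, f (p + i + q) = f (p + i)} =
      ⋃ p : ℕ, ⋃ q : ℕ, {f : ℕ → α | 0 < q ∧ ∀ i, f (p + i + q) = f (p + i)} := by
    ext f; simp
  rw [this]
  refine Set.countable_iUnion fun p => Set.countable_iUnion fun q => ?_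
  refine Set.countable_of_injective_of_countable_image
    (f := fun (f : ℕ → α) (i : Fin (p + q)) => f i) ?_ (Set.to_countable _)
  rintro f ⟨hq, hf⟩ g ⟨-, hg⟩ hfg
  funext i
  induction i using Nat.strong_induction_on with
  | _ i ih =>
    rcases lt_or_ge i (p + q) with h | h
    · exact congrFun hfg ⟨i, h⟩
    · obtain ⟨j, rfl⟩ := Nat.exists_eq_add_of_le h
      rw [show p + q + j = p + j + q by ring, hf, hg]
      exact ih _ (by omega)

theorem eventually_periodic_of_antiperiodic {m : ℕ} {ε : ℕ → Fin (m + 1)} {p q : ℕ} (hq : 0 < q)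
    (h : ∀ i, ε (p + i + q) = (ε (p + i)).rev) :
    ∃ p q, 0 < q ∧ ∀ i, ε (p + i + q) = ε (p + i) := by
  refine ⟨p, q + q, by omega, fun i => ?_⟩
  rw [show p + i + (q + q) = p + (i + q) + q by ring, h, ← add_assoc, h, Fin.rev_rev]

theorem exists_prefix_sum_ge {m : ℕ} {β : ℝ} (hβ : 1 < β)
    (h : 1 < tval β (dg (dig m tm)) 0) :
    ∃ N : ℕ, 1 ≤ ∑ i ∈ Finset.range (2 ^ N), dg (dig m tm) i / β ^ (i + 1) := by
  have hs := (summable_tval hβ (abs_dg_le (dig m tm)) 0).hasSum.tendsto_sum_nat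
  have ht := hs.comp (tendsto_pow_atTop_atTop_of_one_lt one_lt_two)
  obtain ⟨N, hN⟩ := (ht.eventually_const_lt h).exists
  refine ⟨N, ?_⟩
  simpa using hN.le

theorem countable_S {m : ℕ} (hm : 1 ≤ m) {βc β : ℝ} (hc : IsBetaC m βc) (hβ : 1 < β)
    (h : β < βc) : (S β m).Countable := by
  obtain ⟨-, hc2⟩ := (isBetaC_iff hm).mp hc
  have h1 : 1 < tval β (dg (dig m tm)) 0 := by
    have := tval_dig_tm_lt hm hβ h
    rwa [hc2] at this
  obtain ⟨N, hN⟩ := exists_prefix_sum_ge hβ h1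
  refine countable_eventually_periodic.mono fun ε hε => ?_
  let Q : ℕ → Prop := fun l => ∃ p, Begins ε p l ∨ Begins (refl ε) p l
  have hQN : ¬ Q N := by
    rintro ⟨p, hp | hp⟩
    · exact not_begins hβ hε hN p hp
    · exact not_begins hβ (refl_mem_S hβ hε) hN p hp
  by_cases hQ0 : Q 0
  · obtain ⟨l, hl, hl'⟩ : ∃ l, Q l ∧ ¬ Q (l + 1) := by
      by_contra hcon
      push Not at hcon
      exact hQN (Nat.rec hQ0 (fun l hl => hcon l hl) N)
    have hn : ∀ q, ¬ Begins ε q (l + 1) ∧ ¬ Begins (refl ε) q (l + 1) := fun q =>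
      ⟨fun hq => hl' ⟨q, Or.inl hq⟩, fun hq => hl' ⟨q, Or.inr hq⟩⟩
    obtain ⟨p, hp | hp⟩ := hl
    · exact eventually_periodic_of_antiperiodic (by positivity)
        (antiperiodic_of_begins hβ hm h1.le hε hp hn)
    · have := antiperiodic_of_begins hβ hm h1.le (refl_mem_S hβ hε) hp
        (fun q => by rw [refl_refl]; exact (hn q).symm)
      simp only [refl, Fin.rev_inj] at this
      exact eventually_periodic_of_antiperiodic (p := p) (by positivity : 0 < 2 ^ l)
        fun i => by rw [← this i]
  -- If level 0 never occurs, even after reflection, the digit bounds leave only the digit `m / 2`,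
  -- and the sequence is constant.
  · refine ⟨0, 1, one_pos, fun i => ?_⟩
    have hval : ∀ i, (ε i : ℕ) = m / 2 := fun i => by
      have h2 := digit_bounds hβ hm h1.le hε i
      have h3 : ¬ (ε i : ℕ) = m / 2 + 1 := fun h => hQ0 ⟨i, Or.inl ((begins_zero_iff hm).mpr h)⟩
      have h4 : ¬ ((refl ε) i : ℕ) = m / 2 + 1 := fun h =>
        hQ0 ⟨i, Or.inr ((begins_zero_iff hm).mpr h)⟩
      rw [refl, Fin.val_rev] at h4
      omega
    exact Fin.ext ((hval _).trans (hval _).symm)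

/-! ### The continuum at the critical base -/

theorem tm_two_pow_mul (N y : ℕ) : tm (2 ^ N * y) = tm y := by
  induction N with
  | zero => simp
  | succ N ih => rw [pow_succ', mul_assoc, tm_two_mul, ih]

theorem tm_add_three_mul_two_pow (N : ℕ) {j : ℕ} (hj : j < 2 ^ N) : tm (j + 3 * 2 ^ N) = tm j := by
  rw [show j + 3 * 2 ^ N = 2 ^ (N + 1) + (2 ^ N + j) by ring,
    tm_two_pow_add (N + 1) (by rw [pow_succ]; omega), tm_two_pow_add N hj, Bool.not_not]

/-- For `x = 2 * 2 ^ N` the shift gives `5 * 2 ^ N`: binary `101` against `10`, with different digit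
parity. -/
theorem tm_not_periodic {n N : ℕ} (hn : n + 1 ≤ 2 ^ N) :
    ∃ x, n < x ∧ tm (x + 3 * 2 ^ N) ≠ tm x := by
  refine ⟨2 ^ N * 2, by omega, ?_⟩
  rw [show 2 ^ N * 2 + 3 * 2 ^ N = 2 ^ N * 5 by ring, tm_two_pow_mul, tm_two_pow_mul,
    show 5 = 2 * 2 + 1 by rfl, tm_two_mul_add_one, tm_two]
  simp

theorem eq_of_toNat_cast_eq {a b : Bool} (h : ((a.toNat : ℕ) : ℤ) = b.toNat) : a = b := by
  cases a <;> cases b <;> simp_all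

/-- A digit determines the next bit (from the current one if `m` is even), so a period of the digits
would carry over to Thue–Morse, starting from agreement at `n`. -/
theorem dig_tm_not_periodic {m : ℕ} (hm : 1 ≤ m) {n N : ℕ} (hn : n + 1 ≤ 2 ^ N) :
    ∃ i, dig m tm (n + 3 * 2 ^ N + i) ≠ dig m tm (n + i) := by
  by_contra hcon
  push Not at hcon
  have hper : ∀ i, tm (n + i + 1 + 3 * 2 ^ N) = tm (n + i + 1) := by
    intro i
    induction i with
    | zero =>
      have h1 := dig_val hm tm (n + 3 * 2 ^ N + 0)
      have h2 := dig_val hm tm (n + 0)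
      rw [hcon 0] at h1
      have h3 := tm_add_three_mul_two_pow N (j := n) (by omega)
      simp only [add_zero, h3, show n + 3 * 2 ^ N + 1 = n + 1 + 3 * 2 ^ N by ring] at h1 h2 ⊢
      apply eq_of_toNat_cast_eq
      split at h1 <;> simp_all
    | succ i ih =>
      have h1 := dig_val hm tm (n + 3 * 2 ^ N + (i + 1))
      have h2 := dig_val hm tm (n + (i + 1))
      rw [hcon (i + 1)] at h1
      rw [show n + 3 * 2 ^ N + (i + 1) = n + i + 1 + 3 * 2 ^ N by ring, ih,
        show n + i + 1 + 3 * 2 ^ N + 1 = n + (i + 1) + 1 + 3 * 2 ^ N by ring] at h1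
      rw [← add_assoc n i 1] at h1 h2 ⊢
      apply eq_of_toNat_cast_eq
      split at h1 <;> simp_all
  obtain ⟨x, hx, hne⟩ := tm_not_periodic hn
  obtain ⟨i, rfl⟩ := Nat.exists_eq_add_of_lt hx
  exact hne (hper i)

/-- The shifts of the critical digit sequence. -/
def orbit (m : ℕ) : Set (ℕ → Fin (m + 1)) := Set.range fun n i => dig m tm (n + i)

/-- Adding `3 * 2 ^ N` inserts two binary ones above small indices and keeps their bits. The shifts
by `n + 3 * 2 ^ N` thus converge to the shift by `n` without equalling it for large `N`. -/
theorem preperfect_orbit {m : ℕ} (hm : 1 ≤ m) : Preperfect (orbit m) := by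
  rw [preperfect_iff_nhds]
  rintro _ ⟨n, rfl⟩ U hU
  have hlim : Filter.Tendsto (fun N : ℕ => fun i => dig m tm (n + 3 * 2 ^ N + i)) Filter.atTop
      (nhds fun i => dig m tm (n + i)) := by
    rw [tendsto_pi_nhds]
    intro i
    refine tendsto_const_nhds.congr' ?_
    filter_upwards [Filter.eventually_ge_atTop (n + i + 2)] with N hN
    have hlt : n + i + 1 < 2 ^ N := lt_of_lt_of_le (by omega) (Nat.lt_two_pow_self (n := N)).le
    have h1 := tm_add_three_mul_two_pow N hlt
    have h2 := tm_add_three_mul_two_pow N (by omega : n + i < 2 ^ N)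
    simp only [dig]
    rw [show n + 3 * 2 ^ N + i + 1 = n + i + 1 + 3 * 2 ^ N by ring,
      show n + 3 * 2 ^ N + i = n + i + 3 * 2 ^ N by ring, h1, h2]
  obtain ⟨N, hNU, hN⟩ := ((hlim.eventually_mem hU).and
    (Filter.eventually_ge_atTop (n + 1))).exists
  refine ⟨_, ⟨hNU, ⟨n + 3 * 2 ^ N, rfl⟩⟩, fun heq => ?_⟩
  obtain ⟨i, hi⟩ := dig_tm_not_periodic hm (n := n) (N := N)
    (hN.trans (Nat.lt_two_pow_self (n := N)).le)
  exact hi (congrFun heq i)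

theorem continuum_le_mk_closure_orbit {m : ℕ} (hm : 1 ≤ m) :
    Cardinal.continuum ≤ Cardinal.mk (closure (orbit m)) := by
  let := TopologicalSpace.upgradeIsCompletelyMetrizable (ℕ → Fin (m + 1))
  obtain ⟨f, hf, -, hinj⟩ := (preperfect_orbit hm).perfect_closure.exists_nat_bool_injection
    (Set.Nonempty.closure ⟨_, 0, rfl⟩)
  have h1 : Cardinal.mk (ℕ → Bool) = Cardinal.continuum := by
    simp
  rw [← h1, ← Cardinal.mk_range_eq f hinj]
  exact Cardinal.mk_le_mk_of_subset hf

/-- The sequences all of whose tails have a value in `[(m + 1 - β) / (β - 1), 1]`. -/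
def closedS (β : ℝ) (m : ℕ) : Set (ℕ → Fin (m + 1)) :=
  {ε | ∀ n, |tval β (dg ε) n - mid β m| ≤ 1 - mid β m}

theorem continuous_tval_dg {β : ℝ} (hβ : 1 < β) (m n : ℕ) :
    Continuous fun ε : ℕ → Fin (m + 1) => tval β (dg ε) n := by
  refine continuous_tsum (u := fun i => (m : ℝ) / β ^ (i + 1)) (fun i => ?_)
    (hasSum_geometric_inv hβ m).summable fun i ε => ?_
  · have : Continuous fun d : Fin (m + 1) => ((d : ℕ) : ℝ) := continuous_of_discreteTopology
    exact (this.comp (continuous_apply (n + i))).div_const _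
  · have : (0 : ℝ) < β ^ (i + 1) := by positivity
    rw [Real.norm_eq_abs, abs_div, abs_of_pos this]
    exact div_le_div_of_nonneg_right (abs_dg_le ε _) this.le

theorem isClosed_closedS {β : ℝ} (hβ : 1 < β) (m : ℕ) : IsClosed (closedS β m) := by
  have : closedS β m = ⋂ n, {ε | |tval β (dg ε) n - mid β m| ≤ 1 - mid β m} := by
    ext ε; simp [closedS]
  rw [this]
  exact isClosed_iInter fun n =>
    isClosed_le ((continuous_tval_dg hβ m n).sub continuous_const).abs continuous_const

theorem closure_orbit_subset {m : ℕ} (hm : 1 ≤ m) {βc : ℝ} (hc : IsBetaC m βc) :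
    closure (orbit m) ⊆ closedS βc m := by
  obtain ⟨hc1, hc2⟩ := (isBetaC_iff hm).mp hc
  refine closure_minimal ?_ (isClosed_closedS hc1 m)
  rintro _ ⟨n, rfl⟩ p
  have h1 := abs_tval_dig_le hc1 hm (abs_tval_tm_le hc1) (n + p)
  have h2 := tval_dig_tm hc1 hm
  have h3 := tval_shift βc (dg (dig m tm)) n p
  have h4 : dg (fun i => dig m tm (n + i)) = fun i => dg (dig m tm) (n + i) := rfl
  rw [h4, h3]
  linarith

/-- For `β < m + 1` the closed interval is shorter than one, so two tails in it cannot make up for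
different digits. -/
theorem eq_of_mem_closedS {β : ℝ} (hβ : 1 < β) {m : ℕ} (hm : β < m + 1)
    {ε ε' : ℕ → Fin (m + 1)} (h : ε ∈ closedS β m) (h' : ε' ∈ closedS β m) {p : ℕ}
    (hv : tval β (dg ε) p = tval β (dg ε') p) (i : ℕ) : ε (p + i) = ε' (p + i) := by
  induction i using Nat.strong_induction_on with
  | _ n ih =>
    have hag := tval_sub_of_agree hβ (abs_dg_le ε) (abs_dg_le ε') p p n
      (fun i hi => by simp [dg, ih i hi])
    have hpos : (0 : ℝ) < β ^ n := by positivity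
    have hb : 0 < β := by linarith
    have hb1 : 0 < β - 1 := by linarith
    rw [hv, sub_self, eq_comm, div_eq_zero_iff] at hag
    have hag := hag.resolve_right hpos.ne'
    rw [tval_rec hβ (abs_dg_le ε), tval_rec hβ (abs_dg_le ε'), ← sub_div, div_eq_zero_iff] at hag
    have hag := hag.resolve_right hb.ne'
    have h1 := abs_le.mp (h (p + n + 1))
    have h2 := abs_le.mp (h' (p + n + 1))
    have h3 := two_mul_mid hβ m
    have h4 : 1 < (m : ℝ) / (β - 1) := by rw [lt_div_iff₀ hb1]; linarith
    by_contra hne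
    rcases lt_or_gt_of_ne (fun h => hne (Fin.ext h) : (ε (p + n) : ℕ) ≠ (ε' (p + n) : ℕ))
      with hl | hl
    · have : dg ε (p + n) + 1 ≤ dg ε' (p + n) := by simp only [dg]; exact_mod_cast hl
      linarith
    · have : dg ε' (p + n) + 1 ≤ dg ε (p + n) := by simp only [dg]; exact_mod_cast hl
      linarith

/-- Such a sequence meets an endpoint at some index. The value there determines the tail, and only
finitely many prefixes precede it. -/
theorem countable_closedS_diff {β : ℝ} (hβ : 1 < β) {m : ℕ} (hm : β < m + 1) :
    (closedS β m \ S β m).Countable := by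
  have hcount : ∀ (n : ℕ) (c : ℝ), {ε ∈ closedS β m | tval β (dg ε) n = c}.Countable := by
    intro n c
    refine Set.countable_of_injective_of_countable_image
      (f := fun (ε : ℕ → Fin (m + 1)) (i : Fin n) => ε i) ?_ (Set.to_countable _)
    rintro ε ⟨hε, hc⟩ ε' ⟨hε', hc'⟩ heq
    funext i
    rcases lt_or_ge i n with h | h
    · exact congrFun heq ⟨i, h⟩
    · obtain ⟨j, rfl⟩ := Nat.exists_eq_add_of_le h
      exact eq_of_mem_closedS hβ hm hε hε' (hc.trans hc'.symm) j
  refine (Set.countable_iUnion fun n => (hcount n 1).union (hcount n (2 * mid β m - 1))).mono ?_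
  rintro ε ⟨hε, hS⟩
  simp only [S, Set.mem_ofPred_eq, not_forall, not_lt] at hS
  obtain ⟨n, hn⟩ := hS
  rw [Set.mem_iUnion]
  refine ⟨n, ?_⟩
  have heq := le_antisymm (hε n) hn
  rcases abs_choice (tval β (dg ε) n - mid β m) with h | h
  · left; exact ⟨hε, by linarith⟩
  · right; exact ⟨hε, by linarith⟩

theorem mk_W_betaC {m : ℕ} (hm : 1 ≤ m) {βc : ℝ} (hc : IsBetaC m βc) :
    Cardinal.mk (W βc m) = Cardinal.continuum := by
  have hlt := lt_of_isBetaC hm hc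
  have hc1 := hc.1
  apply le_antisymm
  · rw [← Cardinal.mk_real]
    exact Cardinal.mk_set_le _
  · rw [mk_W hc1 hlt.le]
    by_contra hcon
    push Not at hcon
    have h1 := continuum_le_mk_closure_orbit hm
    have hsub : closure (orbit m) ⊆ S βc m ∪ (closedS βc m \ S βc m) := fun ε hε => by
      by_cases h : ε ∈ S βc m
      · exact Or.inl h
      · exact Or.inr ⟨closure_orbit_subset hm hc hε, h⟩
    have h2 := (h1.trans (Cardinal.mk_le_mk_of_subset hsub)).trans (Cardinal.mk_union_le _ _)
    have h3 : Cardinal.mk ↑(closedS βc m \ S βc m) < Cardinal.continuum :=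
      lt_of_le_of_lt (Cardinal.le_aleph0_iff_set_countable.mpr (countable_closedS_diff hc1 hlt))
        Cardinal.aleph0_lt_continuum
    exact absurd h2 (not_le.mpr (Cardinal.add_lt_of_lt Cardinal.aleph0_le_continuum hcon h3))

/-! ### Prefixing and values of antiperiodic sequences -/

/-- The sequence with first digit `d`, followed by `ε`. -/
def cons {m : ℕ} (d : Fin (m + 1)) (ε : ℕ → Fin (m + 1)) : ℕ → Fin (m + 1)
  | 0 => d
  | i + 1 => ε i

theorem cons_injective {m : ℕ} (d : Fin (m + 1)) : Function.Injective (cons d) :=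
  fun _ _ h => funext fun i => congrFun h (i + 1)

theorem tval_cons_succ (β : ℝ) {m : ℕ} (d : Fin (m + 1)) (ε : ℕ → Fin (m + 1)) (n : ℕ) :
    tval β (dg (cons d ε)) (n + 1) = tval β (dg ε) n := by
  simp only [tval]
  refine tsum_congr fun i => ?_
  rw [show n + 1 + i = n + i + 1 by ring]
  rfl

theorem tval_cons_zero {β : ℝ} (hβ : 1 < β) {m : ℕ} (d : Fin (m + 1)) (ε : ℕ → Fin (m + 1)) :
    tval β (dg (cons d ε)) 0 - mid β m =
      (((d : ℕ) : ℝ) - m / 2 + (tval β (dg ε) 0 - mid β m)) / β := by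
  rw [tval_rec hβ (abs_dg_le _), tval_cons_succ]
  have hb : 0 < β - 1 := by linarith
  have h3 : mid β m * (β - 1) = m / 2 := by rw [mid]; field_simp
  have hβ0 : β ≠ 0 := by linarith
  have h4 : dg (cons d ε) 0 = ((d : ℕ) : ℝ) := rfl
  rw [h4, ← h3]
  field_simp
  ring

/-- A set with an injective self-map that is not surjective is infinite. -/
theorem infinite_of_injective_not_surjective {α : Type*} {f : α → α} (hf : Function.Injective f)
    {Q : Set α} (hQ : Set.MapsTo f Q Q) {x : α} (hx : x ∈ Q) (hx' : x ∉ Set.range f) :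
    Q.Infinite := by
  intro hfin
  have : Finite Q := hfin
  have hinj : Function.Injective (hQ.restrict f Q Q) := fun a b h =>
    Subtype.ext (hf (congrArg Subtype.val h))
  obtain ⟨z, hz⟩ := (Finite.injective_iff_surjective.mp hinj) ⟨x, hx⟩
  exact hx' ⟨z, congrArg Subtype.val hz⟩

theorem tval_of_antiperiodic {β : ℝ} (hβ : 1 < β) {m : ℕ} {ε : ℕ → Fin (m + 1)} {p q : ℕ}
    (h : ∀ i, ε (p + i + q) = (ε (p + i)).rev) (n : ℕ) :
    tval β (dg ε) (p + n + q) - mid β m = -(tval β (dg ε) (p + n) - mid β m) := by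
  have h1 : tval β (dg ε) (p + n + q) = tval β (dg (refl ε)) (p + n) := by
    simp only [tval]
    refine tsum_congr fun i => ?_
    rw [dg, dg, refl, show p + n + q + i = p + (n + i) + q by ring, h, ← add_assoc]
  rw [h1, tval_refl hβ]
  ring

/-- The value at the start of a sequence of antiperiod one. -/
theorem tval_antiperiodic_one {β : ℝ} (hβ : 1 < β) {m : ℕ} {ε : ℕ → Fin (m + 1)} {p : ℕ}
    (h : ∀ i, ε (p + i + 1) = (ε (p + i)).rev) :
    tval β (dg ε) p - mid β m = (dg ε p - m / 2) / (β + 1) := by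
  have h1 := tval_of_antiperiodic hβ h 0
  have h2 := tval_rec hβ (abs_dg_le ε) p
  have hb : 0 < β - 1 := by linarith
  have h3 : mid β m * (β - 1) = m / 2 := by rw [mid]; field_simp
  rw [eq_div_iff (by linarith)] at h2 ⊢
  simp only [add_zero] at h1
  linarith

/-- The value at the start of a sequence of antiperiod two. -/
theorem tval_antiperiodic_two {β : ℝ} (hβ : 1 < β) {m : ℕ} {ε : ℕ → Fin (m + 1)} {p : ℕ}
    (h : ∀ i, ε (p + i + 2) = (ε (p + i)).rev) :
    tval β (dg ε) p - mid β m =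
      ((dg ε p - m / 2) * β + (dg ε (p + 1) - m / 2)) / (β ^ 2 + 1) := by
  have h1 := tval_of_antiperiodic hβ h 0
  have h2 := tval_rec hβ (abs_dg_le ε) p
  have h2' := tval_rec hβ (abs_dg_le ε) (p + 1)
  have hb : 0 < β - 1 := by linarith
  have h3 : mid β m * (β - 1) = m / 2 := by rw [mid]; field_simp
  rw [eq_div_iff (by linarith)] at h2 h2'
  rw [eq_div_iff (by positivity)]
  simp only [add_zero] at h1
  rw [add_assoc p 1 1] at h2'
  norm_num at h2'
  rw [← h3]
  linear_combination β * h2 + h2' + h1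

theorem abs_tval_antiperiodic_one {β : ℝ} (hβ : 1 < β) {m : ℕ} {ε : ℕ → Fin (m + 1)}
    (h : ∀ i, ε (i + 1) = (ε i).rev) (n : ℕ) :
    |tval β (dg ε) n - mid β m| = |tval β (dg ε) 0 - mid β m| := by
  induction n with
  | zero => rfl
  | succ n ih =>
    have := tval_of_antiperiodic hβ (p := 0) (q := 1) (by simpa using h) n
    simp only [zero_add] at this
    rw [this, abs_neg, ih]

/-- The sequence `d, m - d, d, m - d, …` with `d = m / 2 + 1`. -/
def alternating (m : ℕ) (i : ℕ) : Fin (m + 1) :=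
  if i % 2 = 0 then Fin.ofNat (m + 1) (m / 2 + 1) else (Fin.ofNat (m + 1) (m / 2 + 1)).rev

theorem alternating_succ (m i : ℕ) : alternating m (i + 1) = (alternating m i).rev := by
  rcases Nat.mod_two_eq_zero_or_one i with h | h
  · have : (i + 1) % 2 = 1 := by omega
    simp [alternating, h, this]
  · have : (i + 1) % 2 = 0 := by omega
    simp [alternating, h, this]

theorem alternating_zero {m : ℕ} (hm : 1 ≤ m) : (alternating m 0 : ℕ) = m / 2 + 1 := by
  simp only [alternating, Nat.zero_mod, if_true, Fin.ofNat]
  exact Nat.mod_eq_of_lt (by omega)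

theorem alternating_mem_S {β : ℝ} (hβ : 1 < β) {m : ℕ} (hm : 1 ≤ m)
    (h : (((m / 2 : ℕ) : ℝ) + 1 - m / 2) / (β + 1) < 1 - mid β m) : alternating m ∈ S β m := by
  intro n
  rw [abs_tval_antiperiodic_one hβ (alternating_succ m), tval_antiperiodic_one hβ (p := 0)
    (by simpa using alternating_succ m), dg, alternating_zero hm]
  have h1 : (m : ℝ) / 2 ≤ ((m / 2 : ℕ) : ℝ) + 1 := by
    have : m ≤ 2 * (m / 2 + 1) := by omega
    have : (m : ℝ) ≤ 2 * (((m / 2 : ℕ) : ℝ) + 1) := by exact_mod_cast this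
    linarith
  push_cast
  rwa [abs_of_nonneg (div_nonneg (by linarith) (by linarith))]

theorem one_le_tval_of_prefix_sum {β : ℝ} (hβ : 1 < β) {m N : ℕ}
    (hN : 1 ≤ ∑ i ∈ Finset.range (2 ^ N), dg (dig m tm) i / β ^ (i + 1)) :
    1 ≤ tval β (dg (dig m tm)) 0 := by
  have h := sum_le_tval hβ (abs_dg_le (dig m tm)) (dg_nonneg _) 0 (2 ^ N)
  simp only [zero_add] at h
  exact hN.trans h

/-! ### Even `m` -/

theorem even_factor {k : ℕ} (hk : 1 ≤ k) {x : ℝ} (hx : 0 < x) :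
    ∃ g : ℝ, 0 < g ∧ x ^ 2 - ((k : ℝ) + 1) * x - k =
      (x - ((k : ℝ) + 1 + √((k : ℝ) ^ 2 + 6 * k + 1)) / 2) * g := by
  have hk1 : (1 : ℝ) ≤ k := by exact_mod_cast hk
  have hs := Real.sq_sqrt (by positivity : (0 : ℝ) ≤ (k : ℝ) ^ 2 + 6 * k + 1)
  have hlt : (k : ℝ) + 1 < √((k : ℝ) ^ 2 + 6 * k + 1) := Real.lt_sqrt_of_sq_lt (by nlinarith)
  refine ⟨x - ((k : ℝ) + 1 - √((k : ℝ) ^ 2 + 6 * k + 1)) / 2, by linarith, ?_⟩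
  linear_combination (1 / 4 : ℝ) * hs

theorem even_root_iff {k : ℕ} (hk : 1 ≤ k) {x : ℝ} (hx : 0 < x) :
    x ^ 2 - ((k : ℝ) + 1) * x - k = 0 ↔
      x = ((k : ℝ) + 1 + √((k : ℝ) ^ 2 + 6 * k + 1)) / 2 := by
  obtain ⟨g, hg, h⟩ := even_factor hk hx
  rw [h, mul_eq_zero, sub_eq_zero, or_iff_left hg.ne']

theorem even_root_le {k : ℕ} :
    ((k : ℝ) + 1 + √((k : ℝ) ^ 2 + 6 * k + 1)) / 2 ≤ ((2 * k : ℕ) : ℝ) + 1 := by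
  have hk0 : (0 : ℝ) ≤ k := Nat.cast_nonneg k
  have : √((k : ℝ) ^ 2 + 6 * k + 1) ≤ 3 * k + 1 := by
    rw [Real.sqrt_le_left (by positivity)]
    nlinarith
  push_cast
  linarith

theorem mid_even {β : ℝ} (k : ℕ) : mid β (2 * k) = k / (β - 1) := by
  rw [mid]
  push_cast
  rw [mul_div_mul_left _ _ two_ne_zero]

/-- One quadratic serves twice. Its sign makes the critical prefix `k + 1, k` sum to at least one,
which excludes level 1; it also pushes the sequence `k + 1, k - 1, …`, forced by level 0, out of the
interval. -/
theorem even_not_begins {β : ℝ} (hβ : 1 < β) {k : ℕ} (hk : 1 ≤ k)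
    (hp : β ^ 2 - ((k : ℝ) + 1) * β - k ≤ 0) {ε : ℕ → Fin (2 * k + 1)} (hε : ε ∈ S β (2 * k)) :
    1 ≤ tval β (dg (dig (2 * k) tm)) 0 ∧ ∀ p, ¬ Begins ε p 0 := by
  have hm : 1 ≤ 2 * k := by omega
  have hhalf : 2 * k / 2 = k := by omega
  have hb : 0 < β - 1 := by linarith
  have hd0 : dg (dig (2 * k) tm) 0 = k + 1 := by rw [dg_dig_tm_zero hm, hhalf]
  have hd1 : dg (dig (2 * k) tm) 1 = k := by
    rw [dg_dig hm, if_pos (even_two_mul k)]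
    simp [sgn, tm_one, tm_two]
  have hN : 1 ≤ ∑ i ∈ Finset.range (2 ^ 1), dg (dig (2 * k) tm) i / β ^ (i + 1) := by
    simp only [pow_one, Finset.sum_range_succ, Finset.sum_range_zero, hd0, hd1, zero_add]
    have : ((k : ℝ) + 1) / β + k / β ^ (1 + 1) = ((k + 1) * β + k) / β ^ 2 := by
      field_simp
      ring
    rw [this, le_div_iff₀ (by positivity)]
    linarith
  have h1 := one_le_tval_of_prefix_sum hβ hN
  refine ⟨h1, fun p hbeg => ?_⟩
  have hanti := antiperiodic_of_begins hβ hm h1 hε hbeg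
    (fun q => ⟨not_begins hβ hε hN q, not_begins hβ (refl_mem_S hβ hε) hN q⟩)
  simp only [pow_zero] at hanti
  have hv := tval_antiperiodic_one hβ hanti
  have hlt := (abs_lt.mp (hε p)).2
  have hdp : dg ε p = k + 1 := by
    rw [dg, (begins_zero_iff hm).mp hbeg, hhalf]
    push_cast; ring
  rw [hv, hdp, mid_even] at hlt
  push_cast at hlt
  rw [show (k : ℝ) + 1 - 2 * k / 2 = 1 by ring, one_sub_div hb.ne',
    div_lt_div_iff₀ (by linarith) hb] at hlt
  nlinarith

theorem mk_W_even_one {β : ℝ} {k : ℕ} (hk : 1 ≤ k) (hβ : (k : ℝ) + 1 < β)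
    (hβf : β ≤ ((k : ℝ) + 1 + √((k : ℝ) ^ 2 + 6 * k + 1)) / 2) :
    Cardinal.mk (W β (2 * k)) = 1 := by
  have hk1 : (1 : ℝ) ≤ k := by exact_mod_cast hk
  have hβ1 : 1 < β := by linarith
  have hb : 0 < β - 1 := by linarith
  have hm : 1 ≤ 2 * k := by omega
  have hp : β ^ 2 - ((k : ℝ) + 1) * β - k ≤ 0 := by
    obtain ⟨g, hg, h⟩ := even_factor hk (by linarith : 0 < β)
    rw [h]
    exact mul_nonpos_of_nonpos_of_nonneg (by linarith) hg.le
  rw [mk_W hβ1 (hβf.trans even_root_le)]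
  let δ : ℕ → Fin (2 * k + 1) := fun _ => ⟨k, by omega⟩
  have hS : S β (2 * k) = {δ} := by
    ext ε
    rw [Set.mem_singleton_iff]
    constructor
    · intro hε
      obtain ⟨h1, hn⟩ := even_not_begins hβ1 hk hp hε
      obtain ⟨-, hn'⟩ := even_not_begins hβ1 hk hp (refl_mem_S hβ1 hε)
      funext i
      have h2 := digit_bounds hβ1 hm h1 hε i
      have h3 := mt (begins_zero_iff hm).mpr (hn i)
      have h4 := mt (begins_zero_iff hm).mpr (hn' i)
      rw [refl, Fin.val_rev] at h4
      apply Fin.ext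
      change (ε i : ℕ) = k
      omega
    · rintro rfl n
      have : tval β (dg δ) n = mid β (2 * k) := by
        rw [tval, mid_even]
        exact (hasSum_geometric_inv hβ1 (k : ℝ)).tsum_eq
      rw [this, sub_self, abs_zero, mid_even, sub_pos, div_lt_one hb]
      linarith
  rw [hS, Cardinal.mk_singleton]

/-- Prefixing the central digit `k` divides the centred value by `β`, so it preserves `S`; the
alternating sequence starts with `k + 1` and is not reached. -/
theorem infinite_S_even {β : ℝ} {k : ℕ} (hk : 1 ≤ k)
    (hβ : ((k : ℝ) + 1 + √((k : ℝ) ^ 2 + 6 * k + 1)) / 2 < β) : (S β (2 * k)).Infinite := by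
  have hk1 : (1 : ℝ) ≤ k := by exact_mod_cast hk
  have hsq : 1 ≤ √((k : ℝ) ^ 2 + 6 * k + 1) := Real.one_le_sqrt.mpr (by nlinarith)
  have hβ1 : 1 < β := by linarith
  have hb : 0 < β - 1 := by linarith
  have hm : 1 ≤ 2 * k := by omega
  have hhalf : 2 * k / 2 = k := by omega
  have hp : 0 < β ^ 2 - ((k : ℝ) + 1) * β - k := by
    obtain ⟨g, hg, h⟩ := even_factor hk (by linarith : 0 < β)
    rw [h]
    exact mul_pos (by linarith) hg
  refine infinite_of_injective_not_surjective (cons_injective (⟨k, by omega⟩ : Fin (2 * k + 1)))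
    (x := alternating (2 * k)) (fun ε hε n => ?_) (alternating_mem_S hβ1 hm ?_) ?_
  · cases n with
    | zero =>
      rw [tval_cons_zero hβ1]
      push_cast
      rw [show (k : ℝ) - 2 * k / 2 = 0 by ring, zero_add, abs_div, abs_of_pos (by linarith : 0 < β)]
      exact (div_le_self (abs_nonneg _) hβ1.le).trans_lt (hε 0)
    | succ n => rw [tval_cons_succ]; exact hε n
  · rw [hhalf, mid_even]
    push_cast
    rw [show (k : ℝ) + 1 - 2 * k / 2 = 1 by ring, one_sub_div hb.ne',
      div_lt_div_iff₀ (by linarith) hb]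
    nlinarith
  · rintro ⟨ε, hε⟩
    have h0 := alternating_zero hm
    rw [← hε, hhalf] at h0
    simp only [cons] at h0
    omega

theorem mk_W_aleph0 {m : ℕ} (hm : 1 ≤ m) {βc β : ℝ} (hc : IsBetaC m βc) (hβ : 1 < β)
    (h : β < βc) (hinf : (S β m).Infinite) : Cardinal.mk (W β m) = Cardinal.aleph0 := by
  rw [mk_W hβ (h.trans (lt_of_isBetaC hm hc)).le]
  have := (countable_S hm hc hβ h).to_subtype
  have := hinf.to_subtype
  exact Cardinal.mk_eq_aleph0 _

theorem classification_even {k : ℕ} (hk : 1 ≤ k) {βc : ℝ} (hc : IsBetaC (2 * k) βc) :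
    Classification (2 * k) 1 (((k : ℝ) + 1 + √((k : ℝ) ^ 2 + 6 * k + 1)) / 2) βc := by
  have hm : 1 ≤ 2 * k := by omega
  have hhalf : 2 * k / 2 = k := by omega
  have hk1 : (1 : ℝ) ≤ k := by exact_mod_cast hk
  have hsq : 1 ≤ √((k : ℝ) ^ 2 + 6 * k + 1) := Real.one_le_sqrt.mpr (by nlinarith)
  refine ⟨fun β hβ => ?_, fun β hβ => ?_, mk_W_betaC hm hc, fun β hβ =>
    dimH_W_pos hm hc hβ.1 hβ.2⟩
  · have h := hβ.1
    simp only [goldenRatio, hhalf, even_two_mul, if_true] at h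
    rw [mk_W_even_one hk h hβ.2, Nat.cast_one]
  · exact mk_W_aleph0 hm hc (by linarith [hβ.1]) hβ.2 (infinite_S_even hk hβ.1)

/-! ### Odd `m` -/

theorem odd_root_bounds {k : ℕ} {b : ℝ}
    (hb : b ^ 3 - ((k : ℝ) + 2) * b ^ 2 + b - ((k : ℝ) + 1) = 0) :
    (k : ℝ) + 1 ≤ b ∧ b < k + 2 := by
  have h : (b ^ 2 + 1) * ((k : ℝ) + 2 - b) = 1 := by linear_combination -hb
  have hpos : 0 < b ^ 2 + 1 := by positivity
  have h1 : (k : ℝ) + 2 - b = 1 / (b ^ 2 + 1) := by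
    rw [eq_div_iff hpos.ne']; linarith
  have h2 : 0 < 1 / (b ^ 2 + 1) := by positivity
  have h3 : 1 / (b ^ 2 + 1) ≤ 1 := by
    rw [div_le_one hpos]; nlinarith [sq_nonneg b]
  constructor <;> linarith

/-- The cofactor is `x ^ 2 + 1 - (k + 2 - b) * (x + b)`, positive because `k + 2 - b = 1 / (b ^ 2 +
1) ≤ 1 / 2`. -/
theorem odd_factor {k : ℕ} {b : ℝ}
    (hb : b ^ 3 - ((k : ℝ) + 2) * b ^ 2 + b - ((k : ℝ) + 1) = 0) {x : ℝ} (hx : 0 < x) :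
    ∃ g : ℝ, 0 < g ∧ x ^ 3 - ((k : ℝ) + 2) * x ^ 2 + x - ((k : ℝ) + 1) = (x - b) * g := by
  obtain ⟨h1, h2⟩ := odd_root_bounds hb
  have hk0 : (0 : ℝ) ≤ k := Nat.cast_nonneg k
  have hb1 : 1 ≤ b := by linarith
  have h : (b ^ 2 + 1) * ((k : ℝ) + 2 - b) = 1 := by linear_combination -hb
  refine ⟨x ^ 2 + b * x + b ^ 2 - ((k : ℝ) + 2) * (x + b) + 1, ?_, ?_⟩
  · have h3 : (k : ℝ) + 2 - b ≤ 1 / 2 := by nlinarith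
    have h4 : ((k : ℝ) + 2 - b) * (x + b) ≤ x / 2 + 1 / 2 := by
      have h5 : ((k : ℝ) + 2 - b) * b ≤ 1 / 2 := by
        have : 0 ≤ ((k : ℝ) + 2 - b) * (b - 1) ^ 2 :=
          mul_nonneg (by linarith) (sq_nonneg _)
        linarith
      nlinarith
    have h6 : 0 < x ^ 2 + 1 - (x / 2 + 1 / 2) := by nlinarith [sq_nonneg (x - 1 / 4)]
    linarith
  · linear_combination hb

theorem odd_existsUnique_root (k : ℕ) :
    ∃! x : ℝ, x ^ 3 - ((k : ℝ) + 2) * x ^ 2 + x - ((k : ℝ) + 1) = 0 := by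
  have hk0 : (0 : ℝ) ≤ k := Nat.cast_nonneg k
  have hc : ContinuousOn (fun x : ℝ => x ^ 3 - ((k : ℝ) + 2) * x ^ 2 + x - ((k : ℝ) + 1))
      (Set.Icc ((k : ℝ) + 1) (k + 2)) := by fun_prop
  obtain ⟨b, -, hb⟩ := intermediate_value_Icc (by linarith : (k : ℝ) + 1 ≤ k + 2) hc
    (⟨by nlinarith [sq_nonneg ((k : ℝ) + 1)], by nlinarith⟩ :
      (0 : ℝ) ∈ Set.Icc _ _)
  refine ⟨b, hb, fun x hx => ?_⟩
  have hx0 := (odd_root_bounds hx).1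
  obtain ⟨g, hg, h⟩ := odd_factor hb (by linarith : 0 < x)
  rw [hx, eq_comm, mul_eq_zero, or_iff_left hg.ne', sub_eq_zero] at h
  exact h

/-- For the critical prefix `k + 1, k + 1, k, k + 1`, sum at least one means `(β + 1)` times the
cubic is nonpositive. The same sign expels the sequence of antiperiod two forced by level 1. -/
theorem odd_not_begins {β : ℝ} (hβ : 1 < β) {k : ℕ}
    (hp : β ^ 3 - ((k : ℝ) + 2) * β ^ 2 + β - ((k : ℝ) + 1) ≤ 0)
    {ε : ℕ → Fin (2 * k + 1 + 1)} (hε : ε ∈ S β (2 * k + 1)) :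
    1 ≤ tval β (dg (dig (2 * k + 1) tm)) 0 ∧ ∀ p, ¬ Begins ε p 1 := by
  have hm : 1 ≤ 2 * k + 1 := by omega
  have hb : 0 < β - 1 := by linarith
  have hne : ¬ Even (2 * k + 1) := by simp
  have hd0 : dg (dig (2 * k + 1) tm) 0 = k + 1 := by
    rw [dg_dig hm, if_neg hne]
    simp [sgn, tm_one]; ring
  have hd1 : dg (dig (2 * k + 1) tm) 1 = k + 1 := by
    rw [dg_dig hm, if_neg hne]
    simp [sgn, tm_two]; ring
  have hd2 : dg (dig (2 * k + 1) tm) 2 = k := by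
    rw [dg_dig hm, if_neg hne]
    simp [sgn, tm_three]; ring
  have hd3 : dg (dig (2 * k + 1) tm) 3 = k + 1 := by
    rw [dg_dig hm, if_neg hne]
    simp [sgn, tm_four]; ring
  have hN : 1 ≤ ∑ i ∈ Finset.range (2 ^ 2), dg (dig (2 * k + 1) tm) i / β ^ (i + 1) := by
    have : ∑ i ∈ Finset.range (2 ^ 2), dg (dig (2 * k + 1) tm) i / β ^ (i + 1) =
        ((k + 1) * β ^ 3 + (k + 1) * β ^ 2 + k * β + (k + 1)) / β ^ 4 := by
      norm_num only [Finset.sum_range_succ, Finset.sum_range_zero, hd0, hd1, hd2, hd3]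
      field_simp
      ring
    rw [this, le_div_iff₀ (by positivity)]
    have := mul_nonpos_of_nonneg_of_nonpos (by linarith : 0 ≤ β + 1) hp
    linarith
  have h1 := one_le_tval_of_prefix_sum hβ hN
  refine ⟨h1, fun p hbeg => ?_⟩
  have hanti := antiperiodic_of_begins hβ hm h1 hε hbeg
    (fun q => ⟨not_begins hβ hε hN q, not_begins hβ (refl_mem_S hβ hε) hN q⟩)
  simp only [pow_one] at hanti
  have hv := tval_antiperiodic_two hβ hanti
  have hlt := (abs_lt.mp (hε p)).2
  have hdp : dg ε p = k + 1 := by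
    rw [← hd0, dg, dg, ← hbeg 0 (by norm_num), add_zero]
  have hdp1 : dg ε (p + 1) = k + 1 := by
    rw [← hd1, dg, dg, ← hbeg 1 (by norm_num)]
  rw [hv, hdp, hdp1, mid] at hlt
  push_cast at hlt
  rw [one_sub_div (by positivity), div_lt_div_iff₀ (by positivity) (by positivity)] at hlt
  nlinarith

/-- Positivity of this quadratic is what places the alternating sequence in `S`. -/
theorem odd_golden {k : ℕ} {β : ℝ}
    (h : ((k : ℝ) + 1 + √((k : ℝ) ^ 2 + 6 * k + 5)) / 2 < β) :
    1 < β ∧ 0 < β ^ 2 - ((k : ℝ) + 1) * β - (k + 1) := by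
  have hk0 : (0 : ℝ) ≤ k := Nat.cast_nonneg k
  have hs := Real.sq_sqrt (by positivity : (0 : ℝ) ≤ (k : ℝ) ^ 2 + 6 * k + 5)
  have hlt : (k : ℝ) + 1 < √((k : ℝ) ^ 2 + 6 * k + 5) := Real.lt_sqrt_of_sq_lt (by nlinarith)
  refine ⟨by linarith, ?_⟩
  have : β ^ 2 - ((k : ℝ) + 1) * β - (k + 1) =
      (β - ((k : ℝ) + 1 + √((k : ℝ) ^ 2 + 6 * k + 5)) / 2) *
        (β - ((k : ℝ) + 1 - √((k : ℝ) ^ 2 + 6 * k + 5)) / 2) := by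
    linear_combination (1 / 4 : ℝ) * hs
  rw [this]
  exact mul_pos (by linarith) (by linarith)

theorem mk_W_odd_two {β : ℝ} {k : ℕ} {b : ℝ}
    (hb : b ^ 3 - ((k : ℝ) + 2) * b ^ 2 + b - ((k : ℝ) + 1) = 0)
    (hβ : ((k : ℝ) + 1 + √((k : ℝ) ^ 2 + 6 * k + 5)) / 2 < β) (hβf : β ≤ b) :
    Cardinal.mk (W β (2 * k + 1)) = 2 := by
  obtain ⟨hβ1, hG⟩ := odd_golden hβ
  have hk0 : (0 : ℝ) ≤ k := Nat.cast_nonneg k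
  have hb1 : 0 < β - 1 := by linarith
  have hm : 1 ≤ 2 * k + 1 := by omega
  have hhalf : (2 * k + 1) / 2 = k := by omega
  have hp : β ^ 3 - ((k : ℝ) + 2) * β ^ 2 + β - ((k : ℝ) + 1) ≤ 0 := by
    obtain ⟨g, hg, h⟩ := odd_factor hb (by linarith : 0 < β)
    rw [h]
    exact mul_nonpos_of_nonpos_of_nonneg (by linarith) hg.le
  have hle : β ≤ ((2 * k + 1 : ℕ) : ℝ) + 1 := by
    have := (odd_root_bounds hb).2
    push_cast
    linarith
  rw [mk_W hβ1 hle]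
  have halt : alternating (2 * k + 1) ∈ S β (2 * k + 1) := by
    refine alternating_mem_S hβ1 hm ?_
    rw [hhalf, mid]
    push_cast
    rw [one_sub_div (by positivity), div_lt_div_iff₀ (by positivity) (by positivity)]
    nlinarith
  have heq : ∀ ε ∈ S β (2 * k + 1), (ε 0 : ℕ) = k + 1 → ε = alternating (2 * k + 1) := by
    intro ε hε h0
    obtain ⟨h1, hn⟩ := odd_not_begins hβ1 hp hε
    obtain ⟨-, hn'⟩ := odd_not_begins hβ1 hp (refl_mem_S hβ1 hε)
    have hbeg : Begins ε 0 0 := (begins_zero_iff hm).mpr (by rw [h0, hhalf])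
    have hanti := antiperiodic_of_begins hβ1 hm h1 hε hbeg fun q => ⟨hn q, hn' q⟩
    simp only [pow_zero, zero_add] at hanti
    funext i
    induction i with
    | zero => exact Fin.ext (by rw [h0, alternating_zero hm, hhalf])
    | succ i ih => rw [hanti, alternating_succ, ih]
  have hS : S β (2 * k + 1) = {alternating (2 * k + 1), refl (alternating (2 * k + 1))} := by
    ext ε
    rw [Set.mem_insert_iff, Set.mem_singleton_iff]
    constructor
    · intro hε
      obtain ⟨h1, -⟩ := odd_not_begins hβ1 hp hε
      have h2 := digit_bounds hβ1 hm h1 hε 0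
      rcases (by omega : (ε 0 : ℕ) = k + 1 ∨ (ε 0 : ℕ) = k) with h | h
      · exact Or.inl (heq ε hε h)
      · right
        rw [← heq (refl ε) (refl_mem_S hβ1 hε) (by rw [refl, Fin.val_rev]; omega), refl_refl]
    · rintro (rfl | rfl)
      · exact halt
      · exact refl_mem_S hβ1 halt
  have hne : alternating (2 * k + 1) ≠ refl (alternating (2 * k + 1)) := by
    intro h
    have h0 := congrArg Fin.val (congrFun h 0)
    rw [refl, Fin.val_rev, alternating_zero hm] at h0
    omega
  rw [hS, Cardinal.mk_insert (by simpa using hne), Cardinal.mk_singleton]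
  exact one_add_one_eq_two

/-- The digits `k + 1, k + 1, k, k`, repeated. -/
def doubled (k : ℕ) (i : ℕ) : Fin (2 * k + 1 + 1) :=
  if i % 4 < 2 then ⟨k + 1, by omega⟩ else ⟨k, by omega⟩

theorem doubled_add_two (k i : ℕ) : doubled k (i + 2) = (doubled k i).rev := by
  apply Fin.ext
  rw [Fin.val_rev]
  unfold doubled
  by_cases h : i % 4 < 2
  · rw [if_pos h, if_neg (by omega)]; simp only; omega
  · rw [if_neg h, if_pos (by omega)]; simp only; omega

theorem infinite_S_odd {β : ℝ} {k : ℕ} {b : ℝ}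
    (hb : b ^ 3 - ((k : ℝ) + 2) * b ^ 2 + b - ((k : ℝ) + 1) = 0) (hβ : b < β) :
    (S β (2 * k + 1)).Infinite := by
  have hk0 : (0 : ℝ) ≤ k := Nat.cast_nonneg k
  have hb0 := (odd_root_bounds hb).1
  have hβ1 : 1 < β := by linarith
  have hb1 : 0 < β - 1 := by linarith
  have hp : 0 < β ^ 3 - ((k : ℝ) + 2) * β ^ 2 + β - ((k : ℝ) + 1) := by
    obtain ⟨g, hg, h⟩ := odd_factor hb (by linarith : 0 < β)
    rw [h]
    exact mul_pos (by linarith) hg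
  -- The centred value of `doubled k`; it lies inside the interval exactly because the cubic is
  -- positive.
  set V : ℝ := (β + 1) / (2 * (β ^ 2 + 1)) with hV
  have hVS : V < 1 - mid β (2 * k + 1) := by
    rw [hV, mid]
    push_cast
    rw [one_sub_div (by positivity), div_lt_div_iff₀ (by positivity) (by positivity)]
    nlinarith
  have hV0 : 0 < V := by positivity
  have hVhalf : V ≤ 1 / 2 := by
    rw [hV, div_le_div_iff₀ (by positivity) (by positivity)]
    nlinarith
  have hVβ : 1 / 2 ≤ β * V := by
    rw [hV, mul_div_assoc', div_le_div_iff₀ (by positivity) (by positivity)]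
    nlinarith
  -- Stable under prefixing `k + 1, k`: the nonnegative starting value and `1 / 2 ≤ β * V` keep the
  -- tail after `k + 1` at least `-V`, while `V ≤ 1 / 2` keeps it nonpositive.
  let Q : Set (ℕ → Fin (2 * k + 1 + 1)) := {ε | (∀ n, |tval β (dg ε) n - mid β (2 * k + 1)| ≤ V) ∧
    0 ≤ tval β (dg ε) 0 - mid β (2 * k + 1)}
  have hQS : Q ⊆ S β (2 * k + 1) := fun ε hε n => (hε.1 n).trans_lt hVS
  refine Set.Infinite.mono hQS ?_
  let dhi : Fin (2 * k + 1 + 1) := ⟨k + 1, by omega⟩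
  let dlo : Fin (2 * k + 1 + 1) := ⟨k, by omega⟩
  have hβ0 : 0 < β := by linarith
  refine infinite_of_injective_not_surjective
    (f := fun ε => cons dhi (cons dlo ε))
    ((cons_injective dhi).comp (cons_injective dlo)) (x := doubled k) ?_ ?_ ?_
  · rintro ε ⟨hε, hε0⟩
    have hx := (abs_le.mp (hε 0)).2
    have hlo : tval β (dg (cons dlo ε)) 0 - mid β (2 * k + 1) =
        (-(1 / 2) + (tval β (dg ε) 0 - mid β (2 * k + 1))) / β := by
      rw [tval_cons_zero hβ1]
      simp only [dlo]
      push_cast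
      ring
    have hhi : tval β (dg (cons dhi (cons dlo ε))) 0 - mid β (2 * k + 1) =
        (1 / 2 + (tval β (dg (cons dlo ε)) 0 - mid β (2 * k + 1))) / β := by
      rw [tval_cons_zero hβ1]
      simp only [dhi]
      push_cast
      ring
    have hlo1 : -V ≤ tval β (dg (cons dlo ε)) 0 - mid β (2 * k + 1) := by
      rw [hlo, le_div_iff₀ hβ0]; linarith
    have hlo2 : tval β (dg (cons dlo ε)) 0 - mid β (2 * k + 1) ≤ 0 := by
      rw [hlo, div_le_iff₀ hβ0]; linarith
    have hhi1 : 0 ≤ tval β (dg (cons dhi (cons dlo ε))) 0 - mid β (2 * k + 1) := by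
      rw [hhi, le_div_iff₀ hβ0]; linarith
    have hhi2 : tval β (dg (cons dhi (cons dlo ε))) 0 - mid β (2 * k + 1) ≤ V := by
      rw [hhi, div_le_iff₀ hβ0]; linarith
    refine ⟨fun n => ?_, hhi1⟩
    match n with
    | 0 => exact abs_le.mpr ⟨by linarith, hhi2⟩
    | 1 => rw [tval_cons_succ]; exact abs_le.mpr ⟨hlo1, by linarith⟩
    | n + 2 => rw [tval_cons_succ, tval_cons_succ]; exact hε n
  · have hanti : ∀ i, doubled k (0 + i + 2) = (doubled k (0 + i)).rev := fun i => by
      rw [zero_add, doubled_add_two]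
    have h0 : dg (doubled k) 0 = k + 1 := by simp [dg, doubled]
    have h1 : dg (doubled k) 1 = k + 1 := by simp [dg, doubled]
    have hv := tval_antiperiodic_two hβ1 hanti
    rw [zero_add, h0, h1] at hv
    push_cast at hv
    have hv0 : tval β (dg (doubled k)) 0 - mid β (2 * k + 1) = V := by
      rw [hv, hV]; field_simp; ring
    have hv1 : tval β (dg (doubled k)) 1 - mid β (2 * k + 1) = β * V - 1 / 2 := by
      have h2 := tval_rec hβ1 (abs_dg_le (doubled k)) 0
      have h3 : mid β (2 * k + 1) * (β - 1) = k + 1 / 2 := by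
        rw [mid]; push_cast; field_simp
      rw [eq_div_iff hβ0.ne', h0, zero_add] at h2
      rw [← hv0]
      linarith
    have hv1' : β * V - 1 / 2 ≤ V := by
      have : (β - 1) * V ≤ 1 / 2 := by
        rw [hV, mul_div_assoc', div_le_div_iff₀ (by positivity) (by positivity)]
        nlinarith
      linarith
    refine ⟨fun n => ?_, by rw [hv0]; exact hV0.le⟩
    induction n using Nat.twoStepInduction with
    | zero => rw [hv0, abs_of_pos hV0]
    | one => rw [hv1, abs_le]; constructor <;> linarith
    | more n ih _ =>
      have := tval_of_antiperiodic hβ1 hanti n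
      simp only [zero_add] at this
      rw [this, abs_neg]
      exact ih
  -- The second digit of `doubled k` is `k + 1`, whereas prefixing puts `k` there.
  · rintro ⟨ε, hε⟩
    have h1 := congrArg Fin.val (congrFun hε 1)
    simp [cons, doubled, dlo] at h1

theorem classification_odd {k : ℕ} {b βc : ℝ}
    (hb : b ^ 3 - ((k : ℝ) + 2) * b ^ 2 + b - ((k : ℝ) + 1) = 0)
    (hc : IsBetaC (2 * k + 1) βc) : Classification (2 * k + 1) 2 b βc := by
  have hm : 1 ≤ 2 * k + 1 := by omega
  have hhalf : (2 * k + 1) / 2 = k := by omega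
  have hk0 : (0 : ℝ) ≤ k := Nat.cast_nonneg k
  have hb0 := (odd_root_bounds hb).1
  refine ⟨fun β hβ => ?_, fun β hβ => ?_, mk_W_betaC hm hc, fun β hβ =>
    dimH_W_pos hm hc hβ.1 hβ.2⟩
  · have h := hβ.1
    have hne : ¬ Even (2 * k + 1) := by simp
    simp only [goldenRatio, hhalf, if_neg hne] at h
    rw [mk_W_odd_two hb h hβ.2]
    simp
  · exact mk_W_aleph0 hm hc (by linarith [hβ.1]) hβ.2 (infinite_S_odd hb hβ.1)

end BetaExp

theorem mainTheorem3 :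
    (∀ k : ℕ, 1 ≤ k →
      (∃! β : ℝ, BetaExp.IsBetaC (2 * k) β) ∧
      (∀ x : ℝ, 0 < x →
        (x ^ 2 - ((k : ℝ) + 1) * x - k = 0 ↔
          x = ((k : ℝ) + 1 + √((k : ℝ) ^ 2 + 6 * k + 1)) / 2)) ∧
      ∀ βc : ℝ, BetaExp.IsBetaC (2 * k) βc →
        BetaExp.Classification (2 * k) 1
          (((k : ℝ) + 1 + √((k : ℝ) ^ 2 + 6 * k + 1)) / 2) βc) ∧
    (∀ k : ℕ,
      (∃! β : ℝ, BetaExp.IsBetaC (2 * k + 1) β) ∧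
      (∃! x : ℝ, x ^ 3 - ((k : ℝ) + 2) * x ^ 2 + x - ((k : ℝ) + 1) = 0) ∧
      ∀ βf βc : ℝ, βf ^ 3 - ((k : ℝ) + 2) * βf ^ 2 + βf - ((k : ℝ) + 1) = 0 →
        BetaExp.IsBetaC (2 * k + 1) βc →
        BetaExp.Classification (2 * k + 1) 2 βf βc) :=
  ⟨fun _ hk => ⟨BetaExp.existsUnique_isBetaC (by omega), fun _ hx => BetaExp.even_root_iff hk hx,
    fun _ hc => BetaExp.classification_even hk hc⟩,
  fun k => ⟨BetaExp.existsUnique_isBetaC (by omega), BetaExp.odd_existsUnique_root k,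
    fun _ _ hf hc => BetaExp.classification_odd hf hc⟩⟩
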